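/- **Setting.** Let $(X,Y)$ be a random pair in $\mathbb R^p\times\mathbb R$, let $0<\alpha\le 1/2$, and let $\beta^*,\theta^*\in\mathbb R^p$ satisfy, almost surely, $Q_\alpha(Y\mid X)=X^{\mathsf T}\beta^*$ and $\mathbb E\{Y\mid Y\le Q_\alpha(Y\mid X),X\}=X^{\mathsf T}\theta^*$, where $Q_\alpha(Y\mid X)$ is the conditional $\alpha$-quantile of $Y$ given $X$. Let $\bar f,\bar\sigma>0$ and $\upsilon_1\ge 1$, and assume the following. 1. *Residual.* Let $\varepsilon=Y-X^{\mathsf T}\beta^*$. Almost surely over $X$, the conditional distribution function $F_{\varepsilon|X}$ is continuously differentiable, $|F_{\varepsilon|X}(s)-F_{\varepsilon|X}(0)|\le\bar f|s|$ for all $s\in\mathbb R$, and $\operatorname{var}(\min\{\varepsilon,0\}\mid X)\le\bar\sigma^2$. 2. *Covariates.* The matrix $\Sigma=\mathbb E(XX^{\mathsf T})$ exists and is positive definite, and $\mathbb P(|u^{\mathsf T}\Sigma^{-1/2}X|\ge\upsilon_1 s)\le 2e^{-s^2/2}$ for all $s\ge 0$ and all unit vectors $u\in\mathbb R^p$. Let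 $(X_1,Y_1),\dots,(X_n,Y_n)$ be independent copies of $(X,Y)$, and write $\|u\|_\Sigma=(u^{\mathsf T}\Sigma u)^{1/2}$. The first-stage quantile regression estimate is any $$\hat\beta\in\operatorname*{argmin}_{\beta\in\mathbb R^p}\frac1n\sum_{i=1}^n\rho_\alpha(Y_i-X_i^{\mathsf T}\beta),\qquad \rho_\alpha(u)=\{\alpha-\mathbb 1(u<0)\}u .$$ For $\tau>0$ the two-step Huberized expected shortfall estimate is any $$\hat\theta_\tau\in\operatorname*{argmin}_{\theta\in\mathbb R^p}\frac1n\sum_{i=1}^n\ell_\tau(S_i(\hat\beta,\theta)),\qquad S_i(\beta,\theta)=\alpha X_i^{\mathsf T}\theta-\mathbb 1(Y_i\le X_i^{\mathsf T}\beta)Y_i+\{\mathbb 1(Y_i\le X_i^{\mathsf T}\beta)-\alpha\}X_i^{\mathsf T}\beta,$$ where $\ell_\tau(u)=u^2/2$ if $|u|\le\tau$ and $\ell_\tau(u)=\tau|u|-\tau^2/2$ otherwise. **Theorem.** For every $\upsilon_1\ge1$ and all constants $0<c_\tau\le C_\tau$ and $K_1,K_2>0$ there are constants $C_1,C_2,C_3>0$,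 depending only on $\upsilon_1,c_\tau,C_\tau,K_1,K_2$, such that the following holds in the above setting. Let $t>0$ and $r_0>0$ satisfy $$r_0\le K_1\bar\sigma,\qquad \bar f r_0^2\le K_2\,\bar\sigma\sqrt{\frac{p+t}{n}},$$ let $c_\tau\bar\sigma\sqrt{n/(p+t)}\le\tau\le C_\tau\bar\sigma\sqrt{n/(p+t)}$, and let $n\ge C_3(p+t)$. Then there is an event of probability at least $1-3e^{-t}$ on which, whenever $\|\hat\beta-\beta^*\|_\Sigma\le r_0$, $$\alpha\,\|\hat\theta_\tau-\theta^*\|_\Sigma\le C_1\,\bar\sigma\sqrt{\frac{p+t}{n}}+C_2\left(\sqrt{\frac{p+t}{n}}\;r_0+\bar f r_0^2\right).$$ -/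

import Mathlib

open MeasureTheory ProbabilityTheory Set
open scoped Matrix MatrixOrder

noncomputable section

namespace ESReg

/-- Covariate space `ℝ^p` with its Euclidean structure. -/
abbrev Vec (p : ℕ) : Type := EuclideanSpace ℝ (Fin p)

/-! ### Functionals of a probability distribution on the line -/

/-- The `α`-quantile `inf {y : ν(-∞, y] ≥ α}` of a probability measure `ν` on `ℝ`. -/
def quantile (ν : Measure ℝ) (α : ℝ) : ℝ :=
  sInf {y : ℝ | α ≤ ν.real (Iic y)}

/-- `ν` has `α`-level expected shortfall `e`: for `Y ∼ ν` and `q` its `α`-quantile,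
`E(Y | Y ≤ q)` exists and equals `e`. -/
def HasExpectedShortfall (ν : Measure ℝ) (α e : ℝ) : Prop :=
  IntegrableOn (fun y : ℝ => y) (Iic (quantile ν α)) ν ∧
    ∫ y, y ∂(ProbabilityTheory.cond ν (Iic (quantile ν α))) = e

/-! ### Second moments of the covariates -/

/-- `Σ = E(X Xᵀ)` for `X ∼ μ`. -/
def secondMoment {p : ℕ} (μ : Measure (Vec p)) : Matrix (Fin p) (Fin p) ℝ :=
  Matrix.of fun j k => ∫ x, x j * x k ∂μ

/-- `‖u‖_A = (uᵀ A u)^{1/2}`, for a positive semidefinite matrix `A`. -/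
def matNorm {p : ℕ} (A : Matrix (Fin p) (Fin p) ℝ) (u : Vec p) : ℝ :=
  Real.sqrt (u.ofLp ⬝ᵥ (A *ᵥ u.ofLp))

/-- `A^{-1/2} x`, for a positive definite matrix `A`. -/
def whiten {p : ℕ} (A : Matrix (Fin p) (Fin p) ℝ) (x : Vec p) : Vec p :=
  WithLp.toLp 2 ((CFC.sqrt A)⁻¹ *ᵥ x.ofLp)

/-! ### The population

The law of a pair `(X, Y)` is a probability measure `ρ` on `ℝ^p × ℝ`: `ρ.fst` is the law of `X`
and `ρ.condKernel x` is the (regular) conditional law of `Y` given `X = x`. -/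

/-- The conditional law of the residual `ε = Y - Xᵀβ` given `X = x`. -/
def residualLaw {p : ℕ} (ρ : Measure (Vec p × ℝ)) [IsFiniteMeasure ρ] (β x : Vec p) :
    Measure ℝ :=
  (ρ.condKernel x).map (fun y => y - inner ℝ x β)

/-- The joint linear quantile and expected shortfall regression model:
`Q_α(Y | X) = Xᵀβ` and `ES_α(Y | X) = Xᵀθ` almost surely. -/
structure JointModel {p : ℕ} (ρ : Measure (Vec p × ℝ)) [IsFiniteMeasure ρ] (α : ℝ)
    (β θ : Vec p) : Prop where
  quantile_eq : ∀ᵐ x ∂ρ.fst, quantile (ρ.condKernel x) α = inner ℝ x β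
  shortfall_eq : ∀ᵐ x ∂ρ.fst, HasExpectedShortfall (ρ.condKernel x) α (inner ℝ x θ)

/-- Condition on the residual `ε = Y - Xᵀβ`: almost surely over `X`, the conditional distribution
function `F` of `ε` given `X` is continuously differentiable with `|F(s) - F(0)| ≤ f̄ |s|` for all
`s`, and the conditional variance of `ε ∧ 0` given `X` is (finite and) at most `σ̄²`. -/
structure ResidualCondition {p : ℕ} (ρ : Measure (Vec p × ℝ)) [IsFiniteMeasure ρ] (β : Vec p)
    (fbar sbar : ℝ) : Prop where
  contDiff_cdf : ∀ᵐ x ∂ρ.fst, ContDiff ℝ 1 (fun s : ℝ => (residualLaw ρ β x).real (Iic s))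
  cdf_sub_le : ∀ᵐ x ∂ρ.fst, ∀ s : ℝ,
    |(residualLaw ρ β x).real (Iic s) - (residualLaw ρ β x).real (Iic 0)| ≤ fbar * |s|
  variance_le : ∀ᵐ x ∂ρ.fst,
    evariance (fun e : ℝ => min e 0) (residualLaw ρ β x) ≤ ENNReal.ofReal (sbar ^ 2)

/-- Sub-Gaussian covariates with parameter `υ`: `Σ = E(X Xᵀ)` exists and is positive definite, and
`W = Σ^{-1/2} X` satisfies `P(|uᵀW| ≥ υ s) ≤ 2 exp(-s²/2)` for all `s ≥ 0` and unit vectors `u`. -/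
structure SubGaussianCovariates {p : ℕ} (μ : Measure (Vec p)) (υ : ℝ) : Prop where
  memLp_two : MemLp (fun x : Vec p => x) 2 μ
  posDef : (secondMoment μ).PosDef
  tail_le : ∀ u : Vec p, ‖u‖ = 1 → ∀ s : ℝ, 0 ≤ s →
    μ.real {x | υ * s ≤ |inner ℝ u (whiten (secondMoment μ) x)|} ≤ 2 * Real.exp (-s ^ 2 / 2)

/-! ### The two-step estimator -/

/-- The check function `ρ_α(u) = (α - 1(u < 0)) u`. -/
def checkLoss (α u : ℝ) : ℝ := (α - if u < 0 then 1 else 0) * u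

/-- The empirical quantile loss `(1/n) ∑ ρ_α(y_i - x_iᵀβ)`. -/
def qrLoss {n p : ℕ} (α : ℝ) (x : Fin n → Vec p) (y : Fin n → ℝ) (β : Vec p) : ℝ :=
  (1 / (n : ℝ)) * ∑ i, checkLoss α (y i - inner ℝ (x i) β)

/-- `b` is a quantile regression estimate: a global minimizer of the empirical quantile loss. -/
def IsQREstimate {n p : ℕ} (α : ℝ) (x : Fin n → Vec p) (y : Fin n → ℝ) (b : Vec p) : Prop :=
  ∀ β : Vec p, qrLoss α x y b ≤ qrLoss α x y β

/-- The orthogonal score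
`S(β, θ; y, x) = α xᵀθ - 1(y ≤ xᵀβ) y + (1(y ≤ xᵀβ) - α) xᵀβ`. -/
def score {p : ℕ} (α : ℝ) (β θ x : Vec p) (y : ℝ) : ℝ :=
  α * inner ℝ x θ - (if y ≤ inner ℝ x β then 1 else 0) * y
    + ((if y ≤ inner ℝ x β then 1 else 0) - α) * inner ℝ x β

/-- The Huber loss with robustification parameter `τ`. -/
def huber (τ u : ℝ) : ℝ := if |u| ≤ τ then u ^ 2 / 2 else τ * |u| - τ ^ 2 / 2

/-- The second-stage loss `(1/n) ∑ ℓ_τ(S_i(β, θ))`. -/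
def esLoss {n p : ℕ} (α τ : ℝ) (x : Fin n → Vec p) (y : Fin n → ℝ) (β θ : Vec p) : ℝ :=
  (1 / (n : ℝ)) * ∑ i, huber τ (score α β θ (x i) (y i))

/-- `h` is a Huberized expected shortfall estimate with first-stage estimate `b`: a global minimizer
of the second-stage loss `θ ↦ (1/n) ∑ ℓ_τ(S_i(b, θ))`. -/
def IsHuberESEstimate {n p : ℕ} (α τ : ℝ) (x : Fin n → Vec p) (y : Fin n → ℝ) (b h : Vec p) :
    Prop :=
  ∀ θ : Vec p, esLoss α τ x y b h ≤ esLoss α τ x y b θ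

end ESReg

end

/-!
In the whitened coordinates `W = Σ^{-1/2} X`, `η = Σ^{1/2} (β - β*)`, `δ = α Σ^{1/2} (θ - θ*)` the
second-stage loss is the empirical mean of `huber τ (ξ η + ⟨δ, W⟩)`, where `ξ η` is the orthogonal
score at `θ*`, and `α` has disappeared from the quadratic part. Put `q = √((p + t) / n)`. Since
`r₀ ≤ K₁ σ` and `f r₀² ≤ K₂ σ q`, the right-hand side of the claim is of the order `σ q`, so it is
enough to show `‖δ‖ ≤ C σ q` for every minimizer `δ`, uniformly over `‖η‖ ≤ r₀`.

The loss is convex in `δ`, so a minimizer cannot lie beyond a sphere on which the quadratic part of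
the loss exceeds the linear part (`norm_le_of_isMinimizer`). Two estimates are needed.

*Gradient.* The mean of `clip τ (ξ η) ⟨u, W⟩` is of the order `f r₀² + (σ² + r₀²) / τ`: the score
has conditional mean at most `f ⟨η, W⟩²` in absolute value (Neyman orthogonality,
`abs_integral_score_le`), and clipping adds a quadratic bias. At `η = 0` the fluctuation is of the
order `σ q` by Bernstein's inequality, as the score has conditional variance at most `σ²` and `τ` is
of the order `σ / q`. The score is
`1`-Lipschitz in `⟨η, W⟩`, so the increments of the centred process are dominated by products of two
sub-Gaussian variables, and chaining along dyadic nets with `5 ^ (p k)` points at level `k` gives a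
uniform fluctuation `r₀ q` without a logarithmic factor (`exists_event_chaining`).

*Curvature.* The loss is quadratic at the observations with `|ξ 0|`, `|⟨η, W⟩|` and `|⟨δ, W⟩|` small
compared with `τ` (`quadIndicator`). Uniformly in `η` and `δ`, the proportion of the others is at
most a multiple of `q`: for the two linear forms this follows from Markov's inequality for the
empirical measure and the bound on the empirical second moment. By Cauchy–Schwarz these observations
carry a small share of the empirical first absolute moment of `⟨δ, W⟩`, which is bounded below by a
multiple of `‖δ‖` (`empMean_quadIndicator_mul_ge`).
-/

noncomputable section

namespace ESReg

/-! ### Nets and chaining in a Euclidean ball -/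

section Nets

variable {E : Type*} [NormedAddCommGroup E] [NormedSpace ℝ E]

/-- `N` is a finite `1/2`-net of the closed unit ball, contained in that ball. -/
structure IsHalfNet (N : Finset E) : Prop where
  norm_le : ∀ c ∈ N, ‖c‖ ≤ 1
  exists_near : ∀ x : E, ‖x‖ ≤ 1 → ∃ c ∈ N, ‖x - c‖ ≤ 1 / 2

/-- A maximal `1/2`-separated subset of the unit ball is a net of cardinality at most `5 ^ dim`. -/
lemma exists_isHalfNet [FiniteDimensional ℝ E] :
    ∃ N : Finset E, IsHalfNet N ∧ N.card ≤ 5 ^ Module.finrank ℝ E := by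
  classical
  have bound : ∀ s : Finset E, (∀ c ∈ s, ‖c‖ ≤ 1) →
      (∀ c ∈ s, ∀ d ∈ s, c ≠ d → 1 / 2 < ‖c - d‖) → s.card ≤ 5 ^ Module.finrank ℝ E := by
    intro s h1 h2
    have hinj : Function.Injective fun x : E => (2 : ℝ) • x :=
      smul_right_injective E two_ne_zero
    rw [← Finset.card_image_of_injective s hinj]
    apply Besicovitch.card_le_of_separated
    · intro c hc
      obtain ⟨d, hd, rfl⟩ := Finset.mem_image.1 hc
      rw [norm_smul]
      have := h1 d hd
      norm_num
      linarith
    · intro c hc d hd hcd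
      obtain ⟨c, hc', rfl⟩ := Finset.mem_image.1 hc
      obtain ⟨d, hd', rfl⟩ := Finset.mem_image.1 hd
      have := h2 c hc' d hd' (fun h => hcd (by rw [h]))
      rw [← smul_sub, norm_smul]
      norm_num
      linarith
  by_contra hcon
  -- Without a finite net, separated sets could be enlarged for ever.
  have grow : ∀ k : ℕ, ∃ s : Finset E, (∀ c ∈ s, ‖c‖ ≤ 1) ∧
      (∀ c ∈ s, ∀ d ∈ s, c ≠ d → 1 / 2 < ‖c - d‖) ∧ s.card = k := by
    intro k
    induction k with
    | zero => exact ⟨∅, by simp⟩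
    | succ k ih =>
      obtain ⟨s, h1, h2, h3⟩ := ih
      have : ¬ ∀ x : E, ‖x‖ ≤ 1 → ∃ c ∈ s, ‖x - c‖ ≤ 1 / 2 :=
        fun h => hcon ⟨s, ⟨h1, h⟩, bound s h1 h2⟩
      push Not at this
      obtain ⟨x, hx, hxs⟩ := this
      have hxn : x ∉ s := fun h => by
        have := hxs x h
        simp at this
        linarith
      refine ⟨insert x s, ?_, ?_, by rw [Finset.card_insert_of_notMem hxn, h3]⟩
      · intro c hc
        rcases Finset.mem_insert.1 hc with rfl | hc
        exacts [hx, h1 c hc]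
      · intro c hc d hd hcd
        rcases Finset.mem_insert.1 hc with hc' | hc' <;>
          rcases Finset.mem_insert.1 hd with hd' | hd'
        · exact absurd (hc'.trans hd'.symm) hcd
        · rw [hc']; exact hxs d hd'
        · rw [hd', norm_sub_rev]; exact hxs c hc'
        · exact h2 c hc' d hd' hcd
  obtain ⟨s, h1, h2, h3⟩ := grow (5 ^ Module.finrank ℝ E + 1)
  have := bound s h1 h2
  omega

/-- A linear map is controlled by its values on a `1/2`-net. -/
lemma IsHalfNet.norm_apply_le {F : Type*} [NormedAddCommGroup F] [NormedSpace ℝ F] {N : Finset E}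
    (hN : IsHalfNet N) (T : E →L[ℝ] F) {A : ℝ} (hA : ∀ c ∈ N, ‖T c‖ ≤ A) (x : E) :
    ‖T x‖ ≤ 2 * A * ‖x‖ := by
  obtain ⟨c₀, hc₀, -⟩ := hN.exists_near 0 (by simp)
  have hA0 : 0 ≤ A := (norm_nonneg _).trans (hA c₀ hc₀)
  have key : ‖T‖ ≤ A + ‖T‖ / 2 := by
    apply ContinuousLinearMap.opNorm_le_of_unit_norm (by positivity)
    intro x hx
    obtain ⟨c, hc, hxc⟩ := hN.exists_near x hx.le
    calc ‖T x‖ = ‖T c + T (x - c)‖ := by rw [← map_add]; congr 2; abel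
      _ ≤ ‖T c‖ + ‖T (x - c)‖ := norm_add_le _ _
      _ ≤ A + ‖T‖ * ‖x - c‖ := add_le_add (hA c hc) (T.le_opNorm _)
      _ ≤ A + ‖T‖ / 2 := by nlinarith [norm_nonneg T]
  exact (T.le_opNorm x).trans (mul_le_mul_of_nonneg_right (by linarith) (norm_nonneg x))

/-- One step of the successive approximation of a point of the unit ball. -/
lemma IsHalfNet.exists_step {N : Finset E} (hN : IsHalfNet N) {x a : E} {k : ℕ}
    (h : ‖x - a‖ ≤ (1 / 2 : ℝ) ^ k) :
    ∃ c ∈ N, ‖x - (a + (1 / 2 : ℝ) ^ k • c)‖ ≤ (1 / 2 : ℝ) ^ (k + 1) := by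
  have hp : (0 : ℝ) < (1 / 2) ^ k := by positivity
  obtain ⟨c, hc, hxc⟩ := hN.exists_near (((1 / 2 : ℝ) ^ k)⁻¹ • (x - a)) (by
    rw [norm_smul, norm_inv, Real.norm_of_nonneg hp.le, inv_mul_le_iff₀ hp]; simpa using h)
  refine ⟨c, hc, ?_⟩
  have : x - (a + (1 / 2 : ℝ) ^ k • c) =
      (1 / 2 : ℝ) ^ k • (((1 / 2 : ℝ) ^ k)⁻¹ • (x - a) - c) := by
    rw [smul_sub, smul_inv_smul₀ hp.ne']; abel
  rw [this, norm_smul, Real.norm_of_nonneg hp.le, pow_succ]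
  exact mul_le_mul_of_nonneg_left hxc hp.le

variable [DecidableEq E]

/-- The `2⁻ᵏ`-net obtained by adding to `0` suitably scaled points of `N`, `k` times. -/
def netLevel (N : Finset E) : ℕ → Finset E
  | 0 => {0}
  | k + 1 => Finset.image₂ (fun a c => a + (1 / 2 : ℝ) ^ k • c) (netLevel N k) N

lemma card_netLevel_le (N : Finset E) (k : ℕ) : (netLevel N k).card ≤ N.card ^ k := by
  induction k with
  | zero => simp [netLevel]
  | succ k ih =>
    refine (Finset.card_image₂_le _ _ _).trans ?_
    rw [pow_succ]
    exact Nat.mul_le_mul_right _ ih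

lemma IsHalfNet.exists_mem_netLevel {N : Finset E} (hN : IsHalfNet N) {x : E} (hx : ‖x‖ ≤ 1)
    (k : ℕ) : ∃ a ∈ netLevel N k, ‖x - a‖ ≤ (1 / 2 : ℝ) ^ k := by
  induction k with
  | zero => exact ⟨0, by simp [netLevel], by simpa using hx⟩
  | succ k ih =>
    obtain ⟨a, ha, hxa⟩ := ih
    obtain ⟨c, hc, hxc⟩ := hN.exists_step hxa
    exact ⟨_, Finset.mem_image₂_of_mem ha hc, hxc⟩

/-- Chaining: a continuous function whose increments along the links of the dyadic nets are bounded
by `T k` at level `k` oscillates by at most `∑ T k` on the unit ball. -/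
lemma IsHalfNet.abs_sub_le_of_links {N : Finset E} (hN : IsHalfNet N) {F : E → ℝ}
    (hF : Continuous F) {T : ℕ → ℝ} {S : ℝ} (hS : ∀ K, ∑ k ∈ Finset.range K, T k ≤ S)
    (hT : ∀ k, ∀ a ∈ netLevel N k, ∀ c ∈ N, |F (a + (1 / 2 : ℝ) ^ k • c) - F a| ≤ T k)
    {x : E} (hx : ‖x‖ ≤ 1) : |F x - F 0| ≤ S := by
  have key : ∀ K : ℕ, ∃ a ∈ netLevel N K, ‖x - a‖ ≤ (1 / 2 : ℝ) ^ K ∧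
      |F a - F 0| ≤ ∑ k ∈ Finset.range K, T k := by
    intro K
    induction K with
    | zero => exact ⟨0, by simp [netLevel], by simpa using hx, by simp⟩
    | succ K ih =>
      obtain ⟨a, ha, hxa, hFa⟩ := ih
      obtain ⟨c, hc, hxc⟩ := hN.exists_step hxa
      refine ⟨_, Finset.mem_image₂_of_mem ha hc, hxc, ?_⟩
      rw [Finset.sum_range_succ]
      have := hT K a ha c hc
      calc |F (a + (1 / 2 : ℝ) ^ K • c) - F 0|
          = |(F a - F 0) + (F (a + (1 / 2 : ℝ) ^ K • c) - F a)| := by congr 1; ring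
        _ ≤ _ := (abs_add_le _ _).trans (add_le_add hFa this)
  choose a _ hxa hFa using key
  have hlim : Filter.Tendsto a Filter.atTop (nhds x) := by
    rw [tendsto_iff_norm_sub_tendsto_zero]
    refine squeeze_zero (fun _ => norm_nonneg _) (fun K => ?_)
      (tendsto_pow_atTop_nhds_zero_of_lt_one (r := (1 / 2 : ℝ)) (by norm_num) (by norm_num))
    rw [norm_sub_rev]; exact hxa K
  have h2 : Filter.Tendsto (fun K => |F (a K) - F 0|) Filter.atTop (nhds |F x - F 0|) :=
    (((hF.tendsto x).comp hlim).sub_const _).abs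
  exact le_of_tendsto h2 (Filter.Eventually.of_forall fun K => (hFa K).trans (hS K))

end Nets

/-! ### The Huber loss -/

/-- The derivative of the Huber loss: `u` clipped to `[-τ, τ]`. -/
def clip (τ u : ℝ) : ℝ := max (-τ) (min u τ)

section Huber

variable {τ : ℝ}

lemma abs_clip_le (hτ : 0 ≤ τ) (u : ℝ) : |clip τ u| ≤ τ := by
  unfold clip; rw [abs_le]
  exact ⟨le_max_left _ _, max_le (by linarith) (min_le_right _ _)⟩

lemma abs_clip_sub_clip_le (u v : ℝ) : |clip τ u - clip τ v| ≤ |u - v| := by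
  unfold clip
  have h1 := abs_max_sub_max_le_abs (min u τ) (min v τ) (-τ)
  rw [max_comm, max_comm (-τ)]
  refine h1.trans ?_
  simpa using abs_min_sub_min_le_max u τ v τ

lemma abs_clip_le_abs (hτ : 0 ≤ τ) (u : ℝ) : |clip τ u| ≤ |u| := by
  have := abs_clip_sub_clip_le (τ := τ) u 0
  have h0 : clip τ 0 = 0 := by simp [clip, hτ]
  simpa [h0] using this

@[fun_prop]
lemma continuous_clip : Continuous (clip τ) := by unfold clip; fun_prop

/-- The bias of clipping is quadratic. -/
lemma abs_sub_clip_le (hτ : 0 < τ) (u : ℝ) : |u - clip τ u| ≤ u ^ 2 / τ := by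
  rw [le_div_iff₀ hτ]
  unfold clip
  rcases le_total u τ with h | h
  · rw [min_eq_left h]
    rcases le_total (-τ) u with h' | h'
    · rw [max_eq_right h']; simp; positivity
    · rw [max_eq_left h', abs_of_nonpos (by linarith)]; nlinarith
  · rw [min_eq_right h, max_eq_right (by linarith), abs_of_nonneg (by linarith)]; nlinarith

/-- The Huber loss lies above its tangents, and near the origin it is quadratic. -/
lemma huber_add_ge (hτ : 0 < τ) (x h : ℝ) :
    huber τ x + clip τ x * h + (if |x| ≤ τ / 2 ∧ |h| ≤ τ / 2 then h ^ 2 / 2 else 0)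
      ≤ huber τ (x + h) := by
  split_ifs with hc
  · obtain ⟨h1, h2⟩ := hc
    have h3 : |x + h| ≤ τ := (abs_add_le _ _).trans (by linarith)
    have h4 : |x| ≤ τ := by linarith
    rw [huber, huber, if_pos h3, if_pos h4, clip, min_eq_left (abs_le.1 h4).2,
      max_eq_right (abs_le.1 h4).1]
    nlinarith
  · unfold huber clip
    rcases le_total x (-τ) with hx | hx
    · rw [min_eq_left (by linarith), max_eq_left hx, abs_of_nonpos (by linarith : x ≤ 0)]
      have : (if -x ≤ τ then x ^ 2 / 2 else τ * -x - τ ^ 2 / 2) = τ * -x - τ ^ 2 / 2 := by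
        split_ifs with h0
        · have : x = -τ := by linarith
          subst this; ring
        · rfl
      rw [this]
      split_ifs with h5
      · nlinarith [sq_nonneg (x + h + τ)]
      · nlinarith [neg_le_abs (x + h)]
    · rcases le_total x τ with hx' | hx'
      · rw [min_eq_left hx', max_eq_right hx, if_pos (abs_le.2 ⟨hx, hx'⟩)]
        split_ifs with h5
        · nlinarith [sq_nonneg h]
        · push Not at h5
          rcases abs_cases (x + h) with ⟨h6, _⟩ | ⟨h6, _⟩ <;> rw [h6] at h5 ⊢
          · nlinarith [mul_nonneg (sub_nonneg.2 hx') (sub_nonneg.2 h5.le), sq_nonneg (τ - x)]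
          · nlinarith [mul_nonneg (neg_le_iff_add_nonneg.1 hx) (sub_nonneg.2 h5.le),
              sq_nonneg (τ + x)]
      · rw [min_eq_right hx', max_eq_right (by linarith), abs_of_nonneg (by linarith : 0 ≤ x)]
        have : (if x ≤ τ then x ^ 2 / 2 else τ * x - τ ^ 2 / 2) = τ * x - τ ^ 2 / 2 := by
          split_ifs with h0
          · have : x = τ := by linarith
            subst this; ring
          · rfl
        rw [this]
        split_ifs with h5
        · nlinarith [sq_nonneg (x + h - τ)]
        · nlinarith [le_abs_self (x + h)]

lemma huber_add_ge_tangent (hτ : 0 < τ) (x h : ℝ) :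
    huber τ x + clip τ x * h ≤ huber τ (x + h) := by
  refine le_trans ?_ (huber_add_ge hτ x h)
  split_ifs <;> nlinarith [sq_nonneg h]

lemma huber_convex (hτ : 0 < τ) (x h : ℝ) {l : ℝ} (h0 : 0 ≤ l) (h1 : l ≤ 1) :
    huber τ (x + l * h) ≤ (1 - l) * huber τ x + l * huber τ (x + h) := by
  have ha := huber_add_ge_tangent hτ (x + l * h) (-(l * h))
  have hb := huber_add_ge_tangent hτ (x + l * h) ((1 - l) * h)
  rw [show x + l * h + -(l * h) = x by ring] at ha
  rw [show x + l * h + (1 - l) * h = x + h by ring] at hb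
  nlinarith [mul_le_mul_of_nonneg_left ha (sub_nonneg.2 h1), mul_le_mul_of_nonneg_left hb h0]

end Huber

/-! ### Deviations of empirical means -/

section EmpMean

variable {S Ω : Type*}

/-- The empirical mean of `g`. -/
def empMean {n : ℕ} (V : Fin n → Ω → S) (g : S → ℝ) (ω : Ω) : ℝ :=
  (1 / (n : ℝ)) * ∑ i, g (V i ω)


variable {n : ℕ} {V : Fin n → Ω → S} {g h : S → ℝ} {ω : Ω}

lemma empMean_mono (H : ∀ x, g x ≤ h x) : empMean V g ω ≤ empMean V h ω :=
  mul_le_mul_of_nonneg_left (Finset.sum_le_sum fun _ _ => H _) (by positivity)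

lemma empMean_add : empMean V (fun x => g x + h x) ω = empMean V g ω + empMean V h ω := by
  simp [empMean, Finset.sum_add_distrib, mul_add]

lemma empMean_sub : empMean V (fun x => g x - h x) ω = empMean V g ω - empMean V h ω := by
  simp [empMean, Finset.sum_sub_distrib, mul_sub]

lemma empMean_const_mul (c : ℝ) : empMean V (fun x => c * g x) ω = c * empMean V g ω := by
  simp only [empMean, ← Finset.mul_sum]; ring

lemma empMean_nonneg (H : ∀ x, 0 ≤ g x) : 0 ≤ empMean V g ω :=
  mul_nonneg (by positivity) (Finset.sum_nonneg fun _ _ => H _)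

/-- The Cauchy–Schwarz inequality for empirical means. -/
lemma empMean_mul_sq_le : empMean V (fun x => g x * h x) ω ^ 2 ≤
    empMean V (fun x => g x ^ 2) ω * empMean V (fun x => h x ^ 2) ω := by
  simp only [empMean]
  have := Finset.sum_mul_sq_le_sq_mul_sq Finset.univ (fun i => g (V i ω)) (fun i => h (V i ω))
  have h2 : (0 : ℝ) ≤ (1 / (n : ℝ)) ^ 2 := by positivity
  nlinarith [mul_le_mul_of_nonneg_left this h2]

end EmpMean

section Deviation

variable {S Ω : Type*} [MeasurableSpace S] [MeasurableSpace Ω] {ρ : Measure S} {P : Measure Ω}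

/-- `E (g² exp (s |g|)) ≤ V`, a Bernstein-type moment condition at the scale `1 / s`. The bound is
stated for the Lebesgue integral of a nonnegative function, so it includes integrability. -/
def ExpMomentLE (ρ : Measure S) (g : S → ℝ) (s V : ℝ) : Prop :=
  ∫⁻ x, ENNReal.ofReal (g x ^ 2 * Real.exp (s * |g x|)) ∂ρ ≤ ENNReal.ofReal V

lemma ExpMomentLE.integrable_sq_mul_exp {g : S → ℝ} {s V : ℝ} (h : ExpMomentLE ρ g s V)
    (hg : Measurable g) : Integrable (fun x => g x ^ 2 * Real.exp (s * |g x|)) ρ := by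
  refine ⟨by fun_prop, ?_⟩
  rw [hasFiniteIntegral_iff_ofReal (Filter.Eventually.of_forall fun x => by positivity)]
  exact h.trans_lt ENNReal.ofReal_lt_top

lemma ExpMomentLE.integral_le {g : S → ℝ} {s V : ℝ} (h : ExpMomentLE ρ g s V)
    (hg : Measurable g) (hV : 0 ≤ V) : ∫ x, g x ^ 2 * Real.exp (s * |g x|) ∂ρ ≤ V := by
  rw [integral_eq_lintegral_of_nonneg_ae (Filter.Eventually.of_forall fun x => by positivity)
    (by fun_prop)]
  exact ENNReal.toReal_le_of_le_ofReal hV h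

lemma ExpMomentLE.neg {g : S → ℝ} {s V : ℝ} (h : ExpMomentLE ρ g s V) :
    ExpMomentLE ρ (fun x => -g x) s V := by
  simpa [ExpMomentLE] using h

lemma one_le_exp_mul_abs {s x : ℝ} (hs : 0 ≤ s) : 1 ≤ Real.exp (s * |x|) :=
  Real.one_le_exp (by positivity)

lemma ExpMomentLE.integrable [IsProbabilityMeasure ρ] {g : S → ℝ} {s V : ℝ}
    (h : ExpMomentLE ρ g s V) (hg : Measurable g) (hs : 0 ≤ s) : Integrable g ρ := by
  refine ((integrable_const (1 : ℝ)).add (h.integrable_sq_mul_exp hg)).mono'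
    hg.aestronglyMeasurable (Filter.Eventually.of_forall fun x => ?_)
  have h1 := one_le_exp_mul_abs (x := g x) hs
  rw [Real.norm_eq_abs, Pi.add_apply]
  have h2 : |g x| ≤ 1 + |g x| ^ 2 := by nlinarith [sq_nonneg (|g x| - 1)]
  rw [sq_abs] at h2
  nlinarith [sq_nonneg (g x)]

lemma ExpMomentLE.integrable_exp [IsProbabilityMeasure ρ] {g : S → ℝ} {s V : ℝ}
    (h : ExpMomentLE ρ g s V) (hg : Measurable g) (hs : 0 ≤ s) :
    Integrable (fun x => Real.exp (s * g x)) ρ := by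
  refine ((integrable_const (Real.exp s)).add (h.integrable_sq_mul_exp hg)).mono'
    (by fun_prop) (Filter.Eventually.of_forall fun x => ?_)
  rw [Real.norm_of_nonneg (Real.exp_pos _).le, Pi.add_apply]
  have h1 : Real.exp (s * g x) ≤ Real.exp (s * |g x|) :=
    Real.exp_le_exp.2 (mul_le_mul_of_nonneg_left (le_abs_self _) hs)
  refine h1.trans ?_
  rcases le_total |g x| 1 with hx | hx
  · have : Real.exp (s * |g x|) ≤ Real.exp s := Real.exp_le_exp.2 (by nlinarith)
    nlinarith [mul_nonneg (sq_nonneg (g x)) (Real.exp_pos (s * |g x|)).le]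
  · have : 1 ≤ g x ^ 2 := by rw [← sq_abs]; nlinarith
    nlinarith [Real.exp_pos (s * |g x|), Real.exp_pos s]

lemma exp_le_one_add_add_sq_mul_exp (x : ℝ) :
    Real.exp x ≤ 1 + x + x ^ 2 * Real.exp |x| := by
  have h1 : 1 ≤ Real.exp |x| := Real.one_le_exp (abs_nonneg _)
  rcases le_total |x| 1 with hx | hx
  · have := (abs_le.1 (Real.abs_exp_sub_one_sub_id_le hx)).2
    nlinarith [sq_nonneg x]
  · have h2 : 1 ≤ x ^ 2 := by rw [← sq_abs]; nlinarith
    rcases le_total 0 x with h | h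
    · rw [abs_of_nonneg h] at *
      nlinarith [Real.exp_pos x]
    · have h3 : Real.exp x ≤ 1 := Real.exp_le_one_iff.2 h
      rw [abs_of_nonpos h] at hx h1 ⊢
      nlinarith [sq_nonneg x]

lemma ExpMomentLE.integral_exp_le [IsProbabilityMeasure ρ] {g : S → ℝ} {s V : ℝ}
    (h : ExpMomentLE ρ g s V) (hg : Measurable g) (hs : 0 ≤ s) (hV : 0 ≤ V) :
    ∫ x, Real.exp (s * g x) ∂ρ ≤ Real.exp (s * ∫ x, g x ∂ρ + s ^ 2 * V) := by
  have i1 := h.integrable hg hs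
  have i2 := h.integrable_sq_mul_exp hg
  have i3 : Integrable (fun x => 1 + s * g x) ρ := (integrable_const _).add (i1.const_mul s)
  calc ∫ x, Real.exp (s * g x) ∂ρ
      ≤ ∫ x, ((1 + s * g x) + s ^ 2 * (g x ^ 2 * Real.exp (s * |g x|))) ∂ρ := by
        refine integral_mono (h.integrable_exp hg hs)
          (i3.add (i2.const_mul _)) fun x => ?_
        have := exp_le_one_add_add_sq_mul_exp (s * g x)
        rw [abs_mul, abs_of_nonneg hs] at this
        simp only
        linarith
    _ = 1 + s * ∫ x, g x ∂ρ + s ^ 2 * ∫ x, g x ^ 2 * Real.exp (s * |g x|) ∂ρ := by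
        rw [integral_add i3 (i2.const_mul _),
          integral_add (integrable_const _) (i1.const_mul s), integral_const_mul,
          integral_const_mul]
        simp
    _ ≤ 1 + (s * ∫ x, g x ∂ρ + s ^ 2 * V) := by
        nlinarith [mul_le_mul_of_nonneg_left (h.integral_le hg hV) (sq_nonneg s)]
    _ ≤ _ := by linarith [Real.add_one_le_exp (s * ∫ x, g x ∂ρ + s ^ 2 * V)]

/-- `V₁, …, Vₙ` are independent with common law `ρ`. -/
structure IsSample {n : ℕ} (P : Measure Ω) (ρ : Measure S) (V : Fin n → Ω → S) : Prop where
  measurable : ∀ i, Measurable (V i)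
  map_eq : ∀ i, P.map (V i) = ρ
  indep : iIndepFun V P

/-- Chernoff's bound for the upper deviation of an empirical mean. -/
lemma IsSample.measureReal_deviation_le [IsProbabilityMeasure ρ] [IsProbabilityMeasure P] {n : ℕ}
    {V : Fin n → Ω → S} (hV : IsSample P ρ V) (hn : 0 < n) {g : S → ℝ} (hg : Measurable g)
    {s v x : ℝ} (hs : 0 ≤ s) (hv : 0 ≤ v) (h : ExpMomentLE ρ g s v) :
    P.real {ω | x ≤ empMean V g ω - ∫ y, g y ∂ρ} ≤ Real.exp (n * (s ^ 2 * v - s * x)) := by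
  have hn' : (0 : ℝ) < n := by exact_mod_cast hn
  set m := ∫ y, g y ∂ρ
  have hind : iIndepFun (fun i => g ∘ V i) P := hV.indep.comp (fun _ => g) fun _ => hg
  have hmeas : ∀ i, Measurable (g ∘ V i) := fun i => hg.comp (hV.measurable i)
  have hint : ∀ i, Integrable (fun ω => Real.exp (s * (g ∘ V i) ω)) P := fun i => by
    have := h.integrable_exp hg hs
    rw [← hV.map_eq i] at this
    exact this.comp_measurable (hV.measurable i)
  have hset : {ω | x ≤ empMean V g ω - m} =
      {ω | n * (m + x) ≤ (∑ i, g ∘ V i) ω} := by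
    ext ω
    simp only [mem_ofPred_eq, empMean, Finset.sum_apply, Function.comp_apply]
    rw [one_div, le_sub_iff_add_le, add_comm, le_inv_mul_iff₀ hn']
  rw [hset]
  refine (measure_ge_le_exp_mul_mgf _ hs
    (hind.integrable_exp_mul_sum hmeas fun i _ => hint i)).trans ?_
  rw [hind.mgf_sum hmeas]
  have hmgf : ∀ i, mgf (g ∘ V i) P s ≤ Real.exp (s * m + s ^ 2 * v) := fun i => by
    have h1 := h.integral_exp_le hg hs hv
    refine le_trans (le_of_eq ?_) h1
    have : ∫ y, Real.exp (s * g y) ∂(P.map (V i)) = ∫ ω, Real.exp (s * g (V i ω)) ∂P :=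
      integral_map (hV.measurable i).aemeasurable (by fun_prop)
    rw [hV.map_eq i] at this
    exact this.symm
  calc Real.exp (-s * (n * (m + x))) * ∏ i, mgf (g ∘ V i) P s
      ≤ Real.exp (-s * (n * (m + x))) * ∏ _i : Fin n, Real.exp (s * m + s ^ 2 * v) := by
        gcongr with i
        · exact fun i _ => mgf_nonneg
        · exact hmgf i
    _ = _ := by
        rw [Finset.prod_const, ← Real.exp_nat_mul, ← Real.exp_add, Finset.card_univ,
          Fintype.card_fin]
        congr 1; ring

/-- Simultaneous two-sided deviation bound for finitely many empirical means at the scale `b q`. -/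
lemma IsSample.exists_deviation_event [IsProbabilityMeasure ρ] [IsProbabilityMeasure P] {n : ℕ}
    {V : Fin n → Ω → S} (hV : IsSample P ρ V) (hn : 0 < n) {ι : Type*} (T : Finset ι)
    {g : ι → S → ℝ} (hg : ∀ i ∈ T, Measurable (g i)) {κ q b M : ℝ} (hκ : 0 < κ) (hq : 0 ≤ q)
    (hb : 0 < b) (hM : 0 ≤ M) (h : ∀ i ∈ T, ExpMomentLE ρ (g i) (κ * q / b) (b ^ 2 * M))
    (w : ℝ) :
    ∃ G : Set Ω, MeasurableSet G ∧ P.real Gᶜ ≤ T.card * (2 * Real.exp (-(w * (n * q ^ 2)))) ∧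
      ∀ ω ∈ G, ∀ i ∈ T,
        |empMean V (g i) ω - ∫ y, g i y ∂ρ| ≤ b * q * (w / κ + κ * M) := by
  have hmean : ∀ f : S → ℝ, Measurable f → Measurable fun ω => empMean V f ω := fun f hf => by
    unfold empMean
    exact (Finset.measurable_sum _ fun i _ => hf.comp (hV.measurable i)).const_mul _
  set x := b * q * (w / κ + κ * M) with hx
  have hexp : n * ((κ * q / b) ^ 2 * (b ^ 2 * M) - κ * q / b * x) = -(w * (n * q ^ 2)) := by
    rw [hx]; field_simp; ring
  have one : ∀ f : S → ℝ, Measurable f → ExpMomentLE ρ f (κ * q / b) (b ^ 2 * M) →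
      P.real {ω | x ≤ empMean V f ω - ∫ y, f y ∂ρ} ≤ Real.exp (-(w * (n * q ^ 2))) := by
    intro f hf hm
    rw [← hexp]
    exact hV.measureReal_deviation_le hn hf (by positivity) (by positivity) hm
  let B : ι → Set Ω := fun i => {ω | x ≤ empMean V (g i) ω - ∫ y, g i y ∂ρ} ∪
    {ω | x ≤ empMean V (fun y => -g i y) ω - ∫ y, -g i y ∂ρ}
  have hB : ∀ i ∈ T, MeasurableSet (B i) := fun i hi =>
    (measurableSet_le measurable_const ((hmean _ (hg i hi)).sub_const _)).union
      (measurableSet_le measurable_const ((hmean _ (hg i hi).neg).sub_const _))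
  refine ⟨(⋃ i ∈ T, B i)ᶜ, (Finset.measurableSet_biUnion T hB).compl, ?_, ?_⟩
  · rw [compl_compl]
    refine (measureReal_biUnion_finset_le T B).trans ?_
    rw [← nsmul_eq_mul]
    refine Finset.sum_le_card_nsmul _ _ _ fun i hi => ?_
    refine (measureReal_union_le _ _).trans ?_
    have h1 := one _ (hg i hi) (h i hi)
    have h2 := one (fun y => -g i y) (hg i hi).neg (h i hi).neg
    linarith
  · intro ω hω i hi
    simp only [mem_compl_iff, mem_iUnion, not_exists] at hω
    have := hω i hi
    simp only [B, mem_union, mem_ofPred_eq, not_or, not_le] at this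
    obtain ⟨h1, h2⟩ := this
    have h3 : empMean V (fun y => -g i y) ω = -empMean V (g i) ω := by
      simp [empMean]
    rw [h3, integral_neg] at h2
    rw [abs_le]
    constructor <;> linarith

/-- Countably many events of small total failure probability hold simultaneously. -/
lemma exists_event_iInter [IsProbabilityMeasure P] {G : ℕ → Set Ω}
    (hG : ∀ k, MeasurableSet (G k)) {a : ℕ → ℝ} (ha : ∀ k, P.real (G k)ᶜ ≤ a k) {A : ℝ}
    (hA : HasSum a A) : MeasurableSet (⋂ k, G k) ∧ P.real (⋂ k, G k)ᶜ ≤ A := by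
  refine ⟨MeasurableSet.iInter hG, ?_⟩
  have ha0 : ∀ k, 0 ≤ a k := fun k => measureReal_nonneg.trans (ha k)
  rw [compl_iInter, Measure.real]
  refine ENNReal.toReal_le_of_le_ofReal (hA.nonneg ha0) ((measure_iUnion_le _).trans ?_)
  rw [← hA.tsum_eq, ENNReal.ofReal_tsum_of_nonneg ha0 hA.summable]
  refine ENNReal.tsum_le_tsum fun k => ?_
  rw [← ENNReal.ofReal_toReal (measure_ne_top P (G k)ᶜ)]
  exact ENNReal.ofReal_le_ofReal (ha k)

end Deviation

/-! ### The whitened model and its moments -/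

/-- A sub-Gaussian tail bound yields a square-exponential moment. -/
lemma lintegral_exp_sq_le_of_tail {S : Type*} [MeasurableSpace S] {ρ : Measure S}
    [IsProbabilityMeasure ρ] {Z : S → ℝ} (hZ : Measurable Z) {υ : ℝ} (hυ : 0 < υ)
    (h : ∀ s : ℝ, 0 ≤ s → ρ.real {x | υ * s ≤ |Z x|} ≤ 2 * Real.exp (-s ^ 2 / 2)) :
    ∫⁻ x, ENNReal.ofReal (Real.exp (1 / (4 * υ ^ 2) * Z x ^ 2)) ∂ρ ≤ 3 := by
  rw [lintegral_eq_lintegral_meas_le ρ (Filter.Eventually.of_forall fun x => (Real.exp_pos _).le)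
    (by fun_prop), ← Ioc_union_Ioi_eq_Ioi (zero_le_one' ℝ)]
  refine (lintegral_union_le _ _ _).trans ?_
  have h1 : ∫⁻ t in Ioc (0 : ℝ) 1, ρ {a | t ≤ Real.exp (1 / (4 * υ ^ 2) * Z a ^ 2)} ≤ 1 := by
    calc _ ≤ ∫⁻ _t in Ioc (0 : ℝ) 1, 1 := lintegral_mono fun t => prob_le_one
      _ = 1 := by simp
  have h2 : ∫⁻ t in Ioi (1 : ℝ), ρ {a | t ≤ Real.exp (1 / (4 * υ ^ 2) * Z a ^ 2)} ≤ 2 := by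
    calc _ ≤ ∫⁻ t in Ioi (1 : ℝ), ENNReal.ofReal (2 * t ^ (-2 : ℝ)) := by
          refine setLIntegral_mono (by fun_prop) fun t ht => ?_
          have ht1 : (1 : ℝ) < t := ht
          have hl : 0 < Real.log t := Real.log_pos ht1
          have key := h (2 * Real.sqrt (Real.log t)) (by positivity)
          have e1 : Real.exp (-(2 * Real.sqrt (Real.log t)) ^ 2 / 2) = t ^ (-2 : ℝ) := by
            rw [mul_pow, Real.sq_sqrt hl.le, Real.rpow_def_of_pos (by linarith)]
            congr 1; ring
          rw [e1] at key
          rw [← ENNReal.ofReal_toReal (measure_ne_top ρ _)]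
          refine ENNReal.ofReal_le_ofReal (le_trans (measureReal_mono ?_) key)
          intro a ha
          simp only [mem_ofPred_eq] at ha ⊢
          rw [← Real.log_le_iff_le_exp (by linarith), one_div,
            le_inv_mul_iff₀ (by positivity)] at ha
          apply abs_le_of_sq_le_sq' _ (abs_nonneg _) |>.2
          rw [sq_abs, mul_pow, mul_pow, Real.sq_sqrt hl.le]
          linarith
      _ = ENNReal.ofReal (∫ t in Ioi (1 : ℝ), 2 * t ^ (-2 : ℝ)) := by
          rw [ofReal_integral_eq_lintegral_ofReal]
          · exact (integrableOn_Ioi_rpow_of_lt (by norm_num) one_pos).const_mul 2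
          · filter_upwards [ae_restrict_mem measurableSet_Ioi] with t ht
            have : (0 : ℝ) < t := lt_trans one_pos ht
            positivity
      _ ≤ 2 := by
          rw [integral_const_mul, integral_Ioi_rpow_of_lt (by norm_num) one_pos]
          norm_num
  calc _ ≤ (1 : ENNReal) + 2 := add_le_add h1 h2
    _ = 3 := by norm_num

/-- The population in whitened coordinates. `W` is the whitened covariate, and `ξ η` is the
orthogonal score at the true second-stage parameter when the first-stage parameter is off by `η`.
The score is Lipschitz in `η`, its value at `η = 0` has conditional second moment at most `σ²`, and
its conditional mean is quadratic in `η` with curvature `f` (Neyman orthogonality). -/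
structure WhitenedModel {S : Type*} [MeasurableSpace S] {p : ℕ} (ρ : Measure S) (W : S → Vec p)
    (ξ : Vec p → S → ℝ) (c σ f : ℝ) : Prop where
  measurable_cov : Measurable W
  measurable_score : ∀ η, Measurable (ξ η)
  exp_sq : ∀ u, ‖u‖ ≤ 1 → ∫⁻ s, ENNReal.ofReal (Real.exp (c * inner ℝ u (W s) ^ 2)) ∂ρ ≤ 3
  second_moment : ∀ u, ∫ s, inner ℝ u (W s) ^ 2 ∂ρ = ‖u‖ ^ 2
  lipschitz : ∀ η η' s, |ξ η s - ξ η' s| ≤ |inner ℝ (η - η') (W s)|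
  variance_le : ∀ g : Vec p → ENNReal, Measurable g →
    ∫⁻ s, ENNReal.ofReal (ξ 0 s ^ 2) * g (W s) ∂ρ ≤ ENNReal.ofReal (σ ^ 2) * ∫⁻ s, g (W s) ∂ρ
  orthogonal : ∀ η u, Integrable (fun s => ξ η s * inner ℝ u (W s)) ρ →
    Integrable (fun s => inner ℝ η (W s) ^ 2 * |inner ℝ u (W s)|) ρ →
    |∫ s, ξ η s * inner ℝ u (W s) ∂ρ| ≤
    f * ∫ s, inner ℝ η (W s) ^ 2 * |inner ℝ u (W s)| ∂ρ

namespace WhitenedModel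

variable {S : Type*} [MeasurableSpace S] {p : ℕ} {ρ : Measure S}
  {W : S → Vec p} {ξ : Vec p → S → ℝ} {c σ f : ℝ}

lemma measurable_inner (h : WhitenedModel ρ W ξ c σ f) (u : Vec p) :
    Measurable fun s => inner ℝ u (W s) :=
  (continuous_const.inner continuous_id).measurable.comp h.measurable_cov

lemma integrable_exp_sq (h : WhitenedModel ρ W ξ c σ f) {u : Vec p} (hu : ‖u‖ ≤ 1) :
    Integrable (fun s => Real.exp (c * inner ℝ u (W s) ^ 2)) ρ := by
  have := h.measurable_inner u
  refine ⟨Measurable.aestronglyMeasurable (by fun_prop), ?_⟩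
  rw [hasFiniteIntegral_iff_ofReal (Filter.Eventually.of_forall fun x => by positivity)]
  exact (h.exp_sq u hu).trans_lt (by norm_num)

lemma integral_exp_sq_le (h : WhitenedModel ρ W ξ c σ f) {u : Vec p} (hu : ‖u‖ ≤ 1) :
    ∫ s, Real.exp (c * inner ℝ u (W s) ^ 2) ∂ρ ≤ 3 := by
  have := h.measurable_inner u
  rw [integral_eq_lintegral_of_nonneg_ae (Filter.Eventually.of_forall fun x => by positivity)
    (Measurable.aestronglyMeasurable (by fun_prop))]
  exact ENNReal.toReal_le_of_le_ofReal (by norm_num) (by simpa using h.exp_sq u hu)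

lemma sq_le_two_mul_exp {x : ℝ} (hx : 0 ≤ x) : x ^ 2 ≤ 2 * Real.exp x := by
  have := Real.quadratic_le_exp_of_nonneg hx
  linarith

lemma integrable_pow_four (h : WhitenedModel ρ W ξ c σ f) (hc : 0 < c) {u : Vec p}
    (hu : ‖u‖ ≤ 1) : Integrable (fun s => inner ℝ u (W s) ^ 4) ρ ∧
      ∫ s, inner ℝ u (W s) ^ 4 ∂ρ ≤ 6 / c ^ 2 := by
  have hm := h.measurable_inner u
  have hle : ∀ s, inner ℝ u (W s) ^ 4 ≤ 2 / c ^ 2 * Real.exp (c * inner ℝ u (W s) ^ 2) := by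
    intro s
    have := sq_le_two_mul_exp (x := c * inner ℝ u (W s) ^ 2) (by positivity)
    rw [div_mul_eq_mul_div, le_div_iff₀ (by positivity)]
    nlinarith
  have hi : Integrable (fun s => inner ℝ u (W s) ^ 4) ρ := by
    refine ((h.integrable_exp_sq hu).const_mul (2 / c ^ 2)).mono'
      (Measurable.aestronglyMeasurable (by fun_prop))
      (Filter.Eventually.of_forall fun s => ?_)
    rw [Real.norm_of_nonneg (by positivity)]
    exact hle s
  refine ⟨hi, (integral_mono hi ((h.integrable_exp_sq hu).const_mul _) hle).trans ?_⟩
  rw [integral_const_mul]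
  calc 2 / c ^ 2 * ∫ s, Real.exp (c * inner ℝ u (W s) ^ 2) ∂ρ ≤ 2 / c ^ 2 * 3 := by
        gcongr; exact h.integral_exp_sq_le hu
    _ = 6 / c ^ 2 := by ring

lemma integrable_sq (h : WhitenedModel ρ W ξ c σ f) (u : Vec p) :
    Integrable (fun s => inner ℝ u (W s) ^ 2) ρ := by
  rcases eq_or_ne u 0 with rfl | hu
  · simp
  · by_contra hcon
    have := h.second_moment u
    rw [integral_undef hcon] at this
    have : ‖u‖ = 0 := by simpa using this.symm
    exact hu (norm_eq_zero.1 this)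

lemma integrable_score_sq_mul (h : WhitenedModel ρ W ξ c σ f) {g : Vec p → ℝ}
    (hg : Measurable g) (hg0 : ∀ w, 0 ≤ g w) (hi : Integrable (fun s => g (W s)) ρ) :
    Integrable (fun s => ξ 0 s ^ 2 * g (W s)) ρ ∧
      ∫ s, ξ 0 s ^ 2 * g (W s) ∂ρ ≤ σ ^ 2 * ∫ s, g (W s) ∂ρ := by
  have hmW := h.measurable_cov
  have hmξ := h.measurable_score 0
  have key := h.variance_le (fun w => ENNReal.ofReal (g w)) hg.ennreal_ofReal
  rw [← ofReal_integral_eq_lintegral_ofReal hi (Filter.Eventually.of_forall fun s => hg0 _),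
    ← ENNReal.ofReal_mul (sq_nonneg _)] at key
  simp_rw [← ENNReal.ofReal_mul (sq_nonneg (ξ 0 _))] at key
  have hnn : ∀ s, 0 ≤ ξ 0 s ^ 2 * g (W s) := fun s => mul_nonneg (sq_nonneg _) (hg0 _)
  refine ⟨⟨by fun_prop, ?_⟩, ?_⟩
  · rw [hasFiniteIntegral_iff_ofReal (Filter.Eventually.of_forall hnn)]
    exact key.trans_lt ENNReal.ofReal_lt_top
  · rw [integral_eq_lintegral_of_nonneg_ae (Filter.Eventually.of_forall hnn) (by fun_prop)]
    exact ENNReal.toReal_le_of_le_ofReal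
      (mul_nonneg (sq_nonneg _) (integral_nonneg fun s => hg0 _)) key

lemma score_sq_le (h : WhitenedModel ρ W ξ c σ f) (η : Vec p) (s : S) :
    ξ η s ^ 2 ≤ 2 * ξ 0 s ^ 2 + 2 * inner ℝ η (W s) ^ 2 := by
  have h1 := h.lipschitz η 0 s
  rw [sub_zero] at h1
  have h2 := sq_le_sq.2 h1
  nlinarith [sq_nonneg (ξ 0 s - (ξ η s - ξ 0 s))]

lemma integral_sq_mul_abs_le (h : WhitenedModel ρ W ξ c σ f) (hc : 0 < c) {v u : Vec p}
    (hv : ‖v‖ ≤ 1) (hu : ‖u‖ ≤ 1) :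
    Integrable (fun s => inner ℝ v (W s) ^ 2 * |inner ℝ u (W s)|) ρ ∧
    ∫ s, inner ℝ v (W s) ^ 2 * |inner ℝ u (W s)| ∂ρ ≤ 6 / c ^ 2 + 1 := by
  have hm := h.measurable_inner u
  have hm' := h.measurable_inner v
  obtain ⟨i4, h4⟩ := h.integrable_pow_four hc hv
  have hle : ∀ s, inner ℝ v (W s) ^ 2 * |inner ℝ u (W s)| ≤
      inner ℝ v (W s) ^ 4 + inner ℝ u (W s) ^ 2 := by
    intro s
    rw [← sq_abs (inner ℝ u (W s))]
    nlinarith [sq_nonneg (inner ℝ v (W s) ^ 2 - |inner ℝ u (W s)|),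
      sq_nonneg (inner ℝ v (W s) ^ 2), sq_nonneg |inner ℝ u (W s)|]
  have hi : Integrable (fun s => inner ℝ v (W s) ^ 2 * |inner ℝ u (W s)|) ρ := by
    refine (i4.add (h.integrable_sq u)).mono' (by fun_prop)
      (Filter.Eventually.of_forall fun s => ?_)
    rw [Real.norm_of_nonneg (by positivity)]
    exact hle s
  refine ⟨hi, (integral_mono hi (i4.add (h.integrable_sq u)) hle).trans ?_⟩
  have := integral_add i4 (h.integrable_sq u)
  simp only [Pi.add_apply] at this ⊢
  rw [this, h.second_moment]
  have : ‖u‖ ^ 2 ≤ 1 := pow_le_one₀ (norm_nonneg _) hu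
  linarith

/-- Bernstein moments of functions dominated by a product of two linear forms. -/
lemma expMomentLE_of_le_mul (h : WhitenedModel ρ W ξ c σ f) (hc : 0 < c) {v u : Vec p}
    (hv : ‖v‖ ≤ 1) (hu : ‖u‖ ≤ 1) {q b : ℝ} (hq : q ≤ 1) (hb : 0 < b)
    {g : S → ℝ} (hg : ∀ s, |g s| ≤ b * (|inner ℝ v (W s)| * |inner ℝ u (W s)|)) :
    ExpMomentLE ρ g (c / 2 * q / b) (b ^ 2 * (48 / c ^ 2)) := by
  have hm := h.measurable_inner u
  have hm' := h.measurable_inner v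
  have key : ∀ s, g s ^ 2 * Real.exp (c / 2 * q / b * |g s|) ≤
      b ^ 2 * (8 / c ^ 2) *
        (Real.exp (c * inner ℝ v (W s) ^ 2) + Real.exp (c * inner ℝ u (W s) ^ 2)) := by
    intro s
    have hgs := hg s
    rw [← sq_abs (inner ℝ v (W s)), ← sq_abs (inner ℝ u (W s)), ← sq_abs (g s)]
    set x := |inner ℝ v (W s)|
    set y := |inner ℝ u (W s)|
    have hx : 0 ≤ x := abs_nonneg _
    have hy : 0 ≤ y := abs_nonneg _
    have e1 : c / 2 * q / b * |g s| ≤ c / 2 * (x * y) := by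
      rw [div_mul_eq_mul_div, div_le_iff₀ hb]
      have : q * |g s| ≤ 1 * (b * (x * y)) := mul_le_mul hq hgs (abs_nonneg _) zero_le_one
      nlinarith
    have e2 : |g s| ^ 2 ≤ b ^ 2 * (x * y) ^ 2 := by
      rw [← mul_pow]; exact pow_le_pow_left₀ (abs_nonneg _) hgs 2
    have e3 : (x * y) ^ 2 ≤ 8 / c ^ 2 * Real.exp (c / 2 * (x * y)) := by
      have := sq_le_two_mul_exp (x := c / 2 * (x * y)) (by positivity)
      rw [div_mul_eq_mul_div, le_div_iff₀ (by positivity)]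
      nlinarith
    have e4 : Real.exp (c * (x * y)) ≤ Real.exp (c * x ^ 2) + Real.exp (c * y ^ 2) := by
      rcases le_total x y with hxy | hxy
      · have : Real.exp (c * (x * y)) ≤ Real.exp (c * y ^ 2) := by
          apply Real.exp_le_exp.2; apply mul_le_mul_of_nonneg_left _ hc.le; nlinarith
        linarith [Real.exp_pos (c * x ^ 2)]
      · have : Real.exp (c * (x * y)) ≤ Real.exp (c * x ^ 2) := by
          apply Real.exp_le_exp.2; apply mul_le_mul_of_nonneg_left _ hc.le; nlinarith
        linarith [Real.exp_pos (c * y ^ 2)]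
    calc |g s| ^ 2 * Real.exp (c / 2 * q / b * |g s|)
        ≤ (b ^ 2 * (8 / c ^ 2 * Real.exp (c / 2 * (x * y)))) * Real.exp (c / 2 * (x * y)) := by
          refine mul_le_mul (e2.trans ?_) (Real.exp_le_exp.2 e1) (Real.exp_pos _).le (by positivity)
          exact mul_le_mul_of_nonneg_left e3 (sq_nonneg b)
      _ = b ^ 2 * (8 / c ^ 2) * Real.exp (c * (x * y)) := by
          rw [show c * (x * y) = c / 2 * (x * y) + c / 2 * (x * y) by ring, Real.exp_add]; ring
      _ ≤ _ := by gcongr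
  have hC : 0 ≤ b ^ 2 * (8 / c ^ 2) := by positivity
  calc ∫⁻ s, ENNReal.ofReal (g s ^ 2 * Real.exp (c / 2 * q / b * |g s|)) ∂ρ
      ≤ ∫⁻ s, ENNReal.ofReal (b ^ 2 * (8 / c ^ 2)) *
          (ENNReal.ofReal (Real.exp (c * inner ℝ v (W s) ^ 2)) +
            ENNReal.ofReal (Real.exp (c * inner ℝ u (W s) ^ 2))) ∂ρ := by
        refine lintegral_mono fun s => ?_
        rw [← ENNReal.ofReal_add (Real.exp_pos _).le (Real.exp_pos _).le, ← ENNReal.ofReal_mul hC]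
        exact ENNReal.ofReal_le_ofReal (key s)
    _ = ENNReal.ofReal (b ^ 2 * (8 / c ^ 2)) *
          (∫⁻ s, ENNReal.ofReal (Real.exp (c * inner ℝ v (W s) ^ 2)) ∂ρ +
            ∫⁻ s, ENNReal.ofReal (Real.exp (c * inner ℝ u (W s) ^ 2)) ∂ρ) := by
        rw [lintegral_const_mul _ (by fun_prop), lintegral_add_left (by fun_prop)]
    _ ≤ ENNReal.ofReal (b ^ 2 * (8 / c ^ 2)) * (3 + 3) := by
        gcongr
        exacts [h.exp_sq v hv, h.exp_sq u hu]
    _ = ENNReal.ofReal (b ^ 2 * (48 / c ^ 2)) := by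
        rw [show ((3 : ENNReal) + 3) = ENNReal.ofReal 6 by norm_num, ← ENNReal.ofReal_mul hC]
        congr 1; ring

lemma sq_mul_exp_le (hc : 0 < c) {D : ℝ} (x : ℝ) :
    x ^ 2 * Real.exp (D * |x|) ≤ 2 * Real.exp ((1 + D) ^ 2 / c) * Real.exp (c * x ^ 2) := by
  have h1 := sq_le_two_mul_exp (abs_nonneg x)
  rw [sq_abs] at h1
  have h2 : |x| + D * |x| ≤ (1 + D) ^ 2 / c + c * x ^ 2 := by
    rw [← sq_abs x, div_add' _ _ _ hc.ne', le_div_iff₀ hc]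
    nlinarith [sq_nonneg ((1 + D) - c * |x|), sq_nonneg ((1 + D) + c * |x|),
      sq_nonneg (1 + D)]
  calc x ^ 2 * Real.exp (D * |x|) ≤ (2 * Real.exp |x|) * Real.exp (D * |x|) := by gcongr
    _ = 2 * Real.exp (|x| + D * |x|) := by rw [Real.exp_add]; ring
    _ ≤ 2 * Real.exp ((1 + D) ^ 2 / c + c * x ^ 2) := by gcongr
    _ = _ := by rw [Real.exp_add]; ring

/-- Bernstein moments of a linear form. -/
lemma expMomentLE_abs (h : WhitenedModel ρ W ξ c σ f) (hc : 0 < c) {u : Vec p} (hu : ‖u‖ ≤ 1)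
    {κ D : ℝ} (hκD : κ ≤ D) :
    ExpMomentLE ρ (fun s => |inner ℝ u (W s)|) κ (6 * Real.exp ((1 + D) ^ 2 / c)) := by
  have hm := h.measurable_inner u
  have hC : 0 ≤ 2 * Real.exp ((1 + D) ^ 2 / c) := by positivity
  calc ∫⁻ s, ENNReal.ofReal (|inner ℝ u (W s)| ^ 2 * Real.exp (κ * |(|inner ℝ u (W s)|)|)) ∂ρ
      ≤ ∫⁻ s, ENNReal.ofReal (2 * Real.exp ((1 + D) ^ 2 / c)) *
          ENNReal.ofReal (Real.exp (c * inner ℝ u (W s) ^ 2)) ∂ρ := by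
        refine lintegral_mono fun s => ?_
        rw [← ENNReal.ofReal_mul hC, abs_abs, sq_abs]
        refine ENNReal.ofReal_le_ofReal (le_trans ?_ (sq_mul_exp_le hc _))
        gcongr
    _ ≤ ENNReal.ofReal (2 * Real.exp ((1 + D) ^ 2 / c)) * 3 := by
        rw [lintegral_const_mul _ (by fun_prop)]
        gcongr
        exact h.exp_sq u hu
    _ = _ := by
        rw [show (3 : ENNReal) = ENNReal.ofReal 3 by norm_num, ← ENNReal.ofReal_mul hC]
        congr 1; ring

/-- Bernstein moments of the clipped score at the true parameter: the conditional variance enters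
through `σ²`, the clipping level only through the scale of the exponential. -/
lemma expMomentLE_clip_mul (h : WhitenedModel ρ W ξ c σ f) (hc : 0 < c) {u : Vec p}
    (hu : ‖u‖ ≤ 1) {κ D τ : ℝ} (hκ : 0 ≤ κ) (hτ : 0 ≤ τ) (hκD : κ * τ ≤ D) :
    ExpMomentLE ρ (fun s => clip τ (ξ 0 s) * inner ℝ u (W s)) κ
      (σ ^ 2 * (6 * Real.exp ((1 + D) ^ 2 / c))) := by
  have hC : 0 ≤ 2 * Real.exp ((1 + D) ^ 2 / c) := by positivity
  have hD : 0 ≤ D := (mul_nonneg hκ hτ).trans hκD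
  have hmg : Measurable fun w : Vec p =>
      ENNReal.ofReal (2 * Real.exp ((1 + D) ^ 2 / c) * Real.exp (c * inner ℝ u w ^ 2)) := by
    have : Measurable fun w : Vec p => inner ℝ u w :=
      (continuous_const.inner continuous_id).measurable
    fun_prop
  have hm := h.measurable_inner u
  calc ∫⁻ s, ENNReal.ofReal ((clip τ (ξ 0 s) * inner ℝ u (W s)) ^ 2 *
        Real.exp (κ * |clip τ (ξ 0 s) * inner ℝ u (W s)|)) ∂ρ
      ≤ ∫⁻ s, ENNReal.ofReal (ξ 0 s ^ 2) * ENNReal.ofReal (2 * Real.exp ((1 + D) ^ 2 / c) *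
          Real.exp (c * inner ℝ u (W s) ^ 2)) ∂ρ := by
        refine lintegral_mono fun s => ?_
        rw [← ENNReal.ofReal_mul (sq_nonneg _)]
        refine ENNReal.ofReal_le_ofReal ?_
        have e1 : clip τ (ξ 0 s) ^ 2 ≤ ξ 0 s ^ 2 := sq_le_sq.2 (abs_clip_le_abs hτ _)
        have e2 : κ * |clip τ (ξ 0 s) * inner ℝ u (W s)| ≤ D * |inner ℝ u (W s)| := by
          rw [abs_mul, ← mul_assoc]
          refine mul_le_mul_of_nonneg_right (le_trans ?_ hκD) (abs_nonneg _)
          exact mul_le_mul_of_nonneg_left (abs_clip_le hτ _) hκ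
        rw [mul_pow, mul_assoc]
        refine mul_le_mul e1 ?_ (by positivity) (sq_nonneg _)
        refine le_trans ?_ (sq_mul_exp_le hc _)
        exact mul_le_mul_of_nonneg_left (Real.exp_le_exp.2 e2) (sq_nonneg _)
    _ ≤ ENNReal.ofReal (σ ^ 2) * ∫⁻ s, ENNReal.ofReal (2 * Real.exp ((1 + D) ^ 2 / c) *
          Real.exp (c * inner ℝ u (W s) ^ 2)) ∂ρ := h.variance_le _ hmg
    _ ≤ ENNReal.ofReal (σ ^ 2) * (ENNReal.ofReal (2 * Real.exp ((1 + D) ^ 2 / c)) * 3) := by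
        simp_rw [ENNReal.ofReal_mul hC]
        rw [lintegral_const_mul _ (by fun_prop)]
        gcongr
        exact h.exp_sq u hu
    _ = _ := by
        rw [show (3 : ENNReal) = ENNReal.ofReal 3 by norm_num, ← ENNReal.ofReal_mul hC,
          ← ENNReal.ofReal_mul (sq_nonneg _)]
        congr 1; ring

lemma measurable_clip_mul (h : WhitenedModel ρ W ξ c σ f) (τ : ℝ) (η u : Vec p) :
    Measurable fun s => clip τ (ξ η s) * inner ℝ u (W s) :=
  (continuous_clip.measurable.comp (h.measurable_score η)).mul (h.measurable_inner u)

lemma continuous_score (h : WhitenedModel ρ W ξ c σ f) (s : S) : Continuous fun η => ξ η s := by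
  have : LipschitzWith ‖W s‖₊ fun η => ξ η s := LipschitzWith.of_dist_le_mul fun η η' => by
    rw [Real.dist_eq, dist_eq_norm, coe_nnnorm, mul_comm]
    exact (h.lipschitz η η' s).trans (abs_real_inner_le_norm _ _)
  exact this.continuous

variable [IsProbabilityMeasure ρ]

lemma integrable_abs (h : WhitenedModel ρ W ξ c σ f) (u : Vec p) :
    Integrable (fun s => |inner ℝ u (W s)|) ρ := by
  have hm := h.measurable_inner u
  refine ((integrable_const (1 : ℝ)).add (h.integrable_sq u)).mono'
    (Measurable.aestronglyMeasurable (by fun_prop))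
    (Filter.Eventually.of_forall fun s => ?_)
  rw [Real.norm_eq_abs, abs_abs, Pi.add_apply, ← sq_abs]
  nlinarith [sq_nonneg (|inner ℝ u (W s)| - 1)]

lemma integral_abs_le (h : WhitenedModel ρ W ξ c σ f) {u : Vec p} (hu : ‖u‖ ≤ 1) :
    ∫ s, |inner ℝ u (W s)| ∂ρ ≤ 1 := by
  have h1 : ∫ s, |inner ℝ u (W s)| ∂ρ ≤ ∫ s, (1 / 2 + 1 / 2 * inner ℝ u (W s) ^ 2) ∂ρ := by
    refine integral_mono (h.integrable_abs u)
      ((integrable_const _).add ((h.integrable_sq u).const_mul _)) fun s => ?_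
    simp only
    rw [← sq_abs (inner ℝ u (W s))]
    nlinarith [sq_nonneg (|inner ℝ u (W s)| - 1)]
  rw [integral_add (integrable_const _) ((h.integrable_sq u).const_mul _), integral_const_mul,
    h.second_moment] at h1
  simp at h1
  nlinarith [norm_nonneg u]

/-- The first absolute moment dominates, because the fourth moment is controlled by the second. -/
lemma integral_abs_ge (h : WhitenedModel ρ W ξ c σ f) (hc : 0 < c) (u : Vec p) :
    c / 8 * ‖u‖ ≤ ∫ s, |inner ℝ u (W s)| ∂ρ := by
  have unit : ∀ u : Vec p, ‖u‖ = 1 → c / 8 ≤ ∫ s, |inner ℝ u (W s)| ∂ρ := by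
    intro u hu
    obtain ⟨i4, h4⟩ := h.integrable_pow_four hc hu.le
    have h1 : ∫ s, inner ℝ u (W s) ^ 2 ∂ρ ≤
        ∫ s, (4 / c * |inner ℝ u (W s)| + c ^ 2 / 16 * inner ℝ u (W s) ^ 4) ∂ρ := by
      refine integral_mono (h.integrable_sq u)
        (((h.integrable_abs u).const_mul _).add (i4.const_mul _)) fun s => ?_
      simp only
      rw [← sq_abs, show inner ℝ u (W s) ^ 4 = |inner ℝ u (W s)| ^ 4 by
        rw [← abs_pow, abs_of_nonneg (by positivity)]]
      set x := |inner ℝ u (W s)|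
      have hx : 0 ≤ x := abs_nonneg _
      -- The first term dominates when `x ≤ 4 / c`, the second when `x ≥ 4 / c`.
      rcases le_total x (4 / c) with hxc | hxc
      · have : x ^ 2 ≤ 4 / c * x := by nlinarith
        have : 0 ≤ c ^ 2 / 16 * x ^ 4 := by positivity
        linarith
      · have h5 : 4 ≤ x * c := by rwa [div_le_iff₀ hc] at hxc
        have h6 : 1 ≤ c ^ 2 / 16 * x ^ 2 := by nlinarith
        have h7 : 0 ≤ 4 / c * x := by positivity
        nlinarith [mul_le_mul_of_nonneg_right h6 (sq_nonneg x)]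
    rw [h.second_moment, hu, integral_add ((h.integrable_abs u).const_mul _) (i4.const_mul _),
      integral_const_mul, integral_const_mul] at h1
    have h2 : c ^ 2 / 16 * ∫ s, inner ℝ u (W s) ^ 4 ∂ρ ≤ c ^ 2 / 16 * (6 / c ^ 2) := by gcongr
    have h3 : c ^ 2 / 16 * (6 / c ^ 2) = 3 / 8 := by field_simp; norm_num
    have h4 : 5 / 8 ≤ 4 / c * ∫ s, |inner ℝ u (W s)| ∂ρ := by linarith
    rw [div_mul_eq_mul_div, le_div_iff₀ hc] at h4
    linarith
  rcases eq_or_ne u 0 with rfl | hu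
  · simp
  · have hpos : 0 < ‖u‖ := norm_pos_iff.2 hu
    have := unit (‖u‖⁻¹ • u) (by rw [norm_smul, norm_inv, norm_norm, inv_mul_cancel₀ hpos.ne'])
    simp only [inner_smul_left, abs_mul] at this
    rw [integral_const_mul] at this
    simp only [map_inv₀, conj_trivial, abs_inv, abs_norm] at this
    rw [le_inv_mul_iff₀ hpos] at this
    linarith

lemma integrable_score_sq (h : WhitenedModel ρ W ξ c σ f) :
    Integrable (fun s => ξ 0 s ^ 2) ρ ∧ ∫ s, ξ 0 s ^ 2 ∂ρ ≤ σ ^ 2 := by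
  simpa using h.integrable_score_sq_mul (g := fun _ => 1) measurable_const (by simp) (by simp)

/-- The mean of the gradient of the Huberized loss at the true parameter: the orthogonality of the
score and the quadratic bias of clipping. -/
lemma abs_integral_clip_mul_le (h : WhitenedModel ρ W ξ c σ f) (hc : 0 < c) (hf : 0 ≤ f)
    {τ r : ℝ} (hτ : 0 < τ) {a u : Vec p} (ha : ‖a‖ ≤ 1) (hu : ‖u‖ ≤ 1) :
    |∫ s, clip τ (ξ (r • a) s) * inner ℝ u (W s) ∂ρ| ≤
      (6 / c ^ 2 + 1) * (f * r ^ 2) + (2 * σ ^ 2 + 2 * (6 / c ^ 2 + 1) * r ^ 2) / τ := by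
  have hm := h.measurable_inner u
  have hm' := h.measurable_inner a
  have hmξ := h.measurable_score (r • a)
  have hmc : Measurable (clip τ) := continuous_clip.measurable
  obtain ⟨i3, h3⟩ := h.integral_sq_mul_abs_le hc ha hu
  obtain ⟨i0, h0⟩ := h.integrable_score_sq_mul (g := fun w => |inner ℝ u w|)
    ((continuous_const.inner continuous_id).abs.measurable) (fun _ => abs_nonneg _)
    (h.integrable_abs u)
  have hK : (0 : ℝ) ≤ 6 / c ^ 2 + 1 := by positivity
  have hsm : ∀ s, inner ℝ (r • a) (W s) = r * inner ℝ a (W s) := fun s => by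
    rw [real_inner_smul_left]
  -- the dominating function for the square of the score
  let B : S → ℝ := fun s => 2 * (ξ 0 s ^ 2 * |inner ℝ u (W s)|) +
    2 * r ^ 2 * (inner ℝ a (W s) ^ 2 * |inner ℝ u (W s)|)
  have iB : Integrable B ρ := (i0.const_mul 2).add (i3.const_mul _)
  have hB : ∀ s, ξ (r • a) s ^ 2 * |inner ℝ u (W s)| ≤ B s := fun s => by
    have := h.score_sq_le (r • a) s
    rw [hsm] at this
    have := mul_le_mul_of_nonneg_right this (abs_nonneg (inner ℝ u (W s)))
    simp only [B]
    nlinarith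
  have hIB : ∫ s, B s ∂ρ ≤ 2 * σ ^ 2 + 2 * (6 / c ^ 2 + 1) * r ^ 2 := by
    rw [integral_add (i0.const_mul 2) (i3.const_mul _), integral_const_mul, integral_const_mul]
    have h5 := mul_le_mul_of_nonneg_left (h.integral_abs_le hu) (sq_nonneg σ)
    have h6 := mul_le_mul_of_nonneg_left h3 (sq_nonneg r)
    nlinarith
  have i1 : Integrable (fun s => ξ (r • a) s * inner ℝ u (W s)) ρ := by
    refine ((h.integrable_abs u).add iB).mono' (by fun_prop)
      (Filter.Eventually.of_forall fun s => ?_)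
    rw [Real.norm_eq_abs, abs_mul, Pi.add_apply]
    refine le_trans ?_ (add_le_add le_rfl (hB s))
    rw [← sq_abs (ξ (r • a) s)]
    have : |ξ (r • a) s| ≤ 1 + |ξ (r • a) s| ^ 2 := by nlinarith [sq_nonneg (|ξ (r • a) s| - 1)]
    nlinarith [mul_le_mul_of_nonneg_right this (abs_nonneg (inner ℝ u (W s)))]
  have hle2 : ∀ s, |(ξ (r • a) s - clip τ (ξ (r • a) s)) * inner ℝ u (W s)| ≤ τ⁻¹ * B s := by
    intro s
    rw [abs_mul]
    calc _ ≤ ξ (r • a) s ^ 2 / τ * |inner ℝ u (W s)| := by gcongr; exact abs_sub_clip_le hτ _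
      _ = τ⁻¹ * (ξ (r • a) s ^ 2 * |inner ℝ u (W s)|) := by ring
      _ ≤ _ := by gcongr; exact hB s
  have i2 : Integrable (fun s => (ξ (r • a) s - clip τ (ξ (r • a) s)) * inner ℝ u (W s)) ρ :=
    (iB.const_mul τ⁻¹).mono' (by fun_prop) (Filter.Eventually.of_forall hle2)
  have hsplit : ∫ s, clip τ (ξ (r • a) s) * inner ℝ u (W s) ∂ρ =
      ∫ s, ξ (r • a) s * inner ℝ u (W s) ∂ρ -
        ∫ s, (ξ (r • a) s - clip τ (ξ (r • a) s)) * inner ℝ u (W s) ∂ρ := by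
    rw [← integral_sub i1 i2]
    congr 1; ext s; ring
  rw [hsplit]
  refine (abs_sub _ _).trans (add_le_add ?_ ?_)
  · have hfun : (fun s => inner ℝ (r • a) (W s) ^ 2 * |inner ℝ u (W s)|) =
        fun s => r ^ 2 * (inner ℝ a (W s) ^ 2 * |inner ℝ u (W s)|) := by
      ext s; rw [hsm]; ring
    refine (h.orthogonal (r • a) u i1 (by rw [hfun]; exact i3.const_mul _)).trans ?_
    have : ∫ s, inner ℝ (r • a) (W s) ^ 2 * |inner ℝ u (W s)| ∂ρ =
        r ^ 2 * ∫ s, inner ℝ a (W s) ^ 2 * |inner ℝ u (W s)| ∂ρ := by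
      rw [hfun, integral_const_mul]
    rw [this]
    have := mul_le_mul_of_nonneg_left h3 (mul_nonneg hf (sq_nonneg r))
    linarith
  · refine (abs_integral_le_integral_abs).trans
      ((integral_mono i2.abs (iB.const_mul τ⁻¹) hle2).trans ?_)
    rw [integral_const_mul, div_eq_inv_mul]
    gcongr

end WhitenedModel

/-! ### Uniform control of the empirical second-stage loss -/

lemma five_pow_le_exp (m : ℕ) : (5 : ℝ) ^ m ≤ Real.exp (2 * m) := by
  have h : (5 : ℝ) ≤ Real.exp 2 := by
    rw [show (2 : ℝ) = 1 + 1 by norm_num, Real.exp_add]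
    nlinarith [Real.exp_one_gt_d9]
  calc (5 : ℝ) ^ m ≤ Real.exp 2 ^ m := by gcongr
    _ = _ := by rw [← Real.exp_nat_mul]; congr 1; ring

lemma two_le_exp_one : (2 : ℝ) ≤ Real.exp 1 := by linarith [Real.exp_one_gt_d9]

/-- The union bound over a family of cardinality `5 ^ (p j)` costs nothing when the exponent is at
least `2 j + 3`. -/
lemma card_mul_exp_le {N p j : ℕ} (hN : N ≤ 5 ^ (p * j)) {w t : ℝ} (hw : 2 * j + 3 ≤ w)
    (ht : 1 ≤ t) : N * (2 * Real.exp (-(w * (p + t)))) ≤ Real.exp (-2 * t) := by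
  have h1 : (N : ℝ) ≤ Real.exp (2 * ((p * j : ℕ) : ℝ)) :=
    le_trans (by exact_mod_cast hN) (five_pow_le_exp _)
  calc N * (2 * Real.exp (-(w * (p + t))))
      ≤ Real.exp (2 * ((p * j : ℕ) : ℝ)) * (Real.exp 1 * Real.exp (-(w * (p + t)))) := by
        gcongr; exact two_le_exp_one
    _ = Real.exp (2 * (p * j) + (1 - w * (p + t))) := by
        rw [← Real.exp_add, ← Real.exp_add]; congr 1; push_cast; ring
    _ ≤ _ := by
        apply Real.exp_le_exp.2
        have hp : (0 : ℝ) ≤ p := Nat.cast_nonneg _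
        have hj : (0 : ℝ) ≤ j := Nat.cast_nonneg _
        nlinarith [mul_le_mul_of_nonneg_right hw (by linarith : 0 ≤ (p : ℝ) + t), mul_nonneg hj hp,
          mul_nonneg hj (by linarith : 0 ≤ t)]

namespace WhitenedModel

variable {S Ω : Type*} [MeasurableSpace S] [MeasurableSpace Ω] {n p : ℕ} {ρ : Measure S}
  [IsProbabilityMeasure ρ] {P : Measure Ω} [IsProbabilityMeasure P] {W : S → Vec p}
  {ξ : Vec p → S → ℝ} {c σ f t q : ℝ} {V : Fin n → Ω → S} {N : Finset (Vec p)}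

/-- The empirical second moment of the whitened covariates is bounded. -/
lemma exists_event_sq_le (h : WhitenedModel ρ W ξ c σ f) (hV : IsSample P ρ V) (hn : 0 < n)
    (hc : 0 < c) (hN : IsHalfNet N) (hcard : N.card ≤ 5 ^ p) (ht : 1 ≤ t) (hq0 : 0 ≤ q)
    (hq : q ≤ 1) (hnq : n * q ^ 2 = p + t) (hqc : q * (34 / c) ≤ 1) :
    ∃ G : Set Ω, MeasurableSet G ∧ P.real Gᶜ ≤ Real.exp (-2 * t) ∧ ∀ ω ∈ G, ∀ u,
      empMean V (fun s => inner ℝ u (W s) ^ 2) ω ≤ 8 * ‖u‖ ^ 2 := by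
  obtain ⟨G, hG, hPG, hdev⟩ := hV.exists_deviation_event hn N
    (g := fun u s => inner ℝ u (W s) ^ 2) (fun u _ => (h.measurable_inner u).pow_const 2)
    (κ := c / 2) (q := q) (b := 1) (M := 48 / c ^ 2) (by positivity) hq0 one_pos (by positivity)
    (fun u hu => h.expMomentLE_of_le_mul hc (hN.norm_le u hu) (hN.norm_le u hu) hq one_pos
      fun s => by rw [one_mul, ← sq, sq_abs, abs_of_nonneg (sq_nonneg _)]) 5
  refine ⟨G, hG, hPG.trans ?_, fun ω hω u => ?_⟩
  · rw [hnq]; exact card_mul_exp_le (j := 1) (by simpa using hcard) (by norm_num) ht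
  have hnet : ∀ u ∈ N, empMean V (fun s => inner ℝ u (W s) ^ 2) ω ≤ 2 := by
    intro u hu
    have h1 := (abs_le.1 (hdev ω hω u hu)).2
    rw [h.second_moment] at h1
    have h2 : ‖u‖ ^ 2 ≤ 1 := pow_le_one₀ (norm_nonneg _) (hN.norm_le u hu)
    have h3 : 1 * q * (5 / (c / 2) + c / 2 * (48 / c ^ 2)) = q * (34 / c) := by
      field_simp; ring
    linarith
  -- The empirical second moment is the squared norm of a linear map.
  let T : Vec p →L[ℝ] EuclideanSpace ℝ (Fin n) :=
    (EuclideanSpace.equiv (Fin n) ℝ).symm.toContinuousLinearMap.comp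
      (ContinuousLinearMap.pi fun i => innerSL ℝ (W (V i ω)))
  have hT : ∀ u, ‖T u‖ ^ 2 = n * empMean V (fun s => inner ℝ u (W s) ^ 2) ω := by
    intro u
    rw [EuclideanSpace.norm_sq_eq, empMean, ← mul_assoc, mul_one_div_cancel
      (by exact_mod_cast hn.ne'), one_mul]
    refine Finset.sum_congr rfl fun i _ => ?_
    simp [T, real_inner_comm]
  have hn' : (0 : ℝ) < n := by exact_mod_cast hn
  have h4 := hN.norm_apply_le T (A := Real.sqrt (n * 2)) (fun u hu => by
    apply Real.le_sqrt_of_sq_le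
    rw [hT]
    exact mul_le_mul_of_nonneg_left (hnet u hu) hn'.le) u
  have h5 := pow_le_pow_left₀ (norm_nonneg _) h4 2
  rw [hT, mul_pow, mul_pow, Real.sq_sqrt (by positivity)] at h5
  nlinarith

/-- The empirical first absolute moment of the whitened covariates is bounded below. -/
lemma exists_event_abs_ge (h : WhitenedModel ρ W ξ c σ f) (hV : IsSample P ρ V) (hn : 0 < n)
    (hc : 0 < c) (hc1 : c ≤ 1) (hN : IsHalfNet N) (hcard : N.card ≤ 5 ^ p) (ht : 1 ≤ t)
    (hq0 : 0 ≤ q) (hq : q ≤ 1) (hnq : n * q ^ 2 = p + t) {k : ℕ}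
    (hk : 6 * (1 / 2 : ℝ) ^ k ≤ c / 64)
    (hqc : q * ((2 * k + 3) / (c / 2) + c / 2 * (6 * Real.exp ((1 + 1) ^ 2 / c))) ≤ c / 64) :
    ∃ G : Set Ω, MeasurableSet G ∧ P.real Gᶜ ≤ Real.exp (-2 * t) ∧ ∀ ω ∈ G,
      (∀ u, empMean V (fun s => inner ℝ u (W s) ^ 2) ω ≤ 8 * ‖u‖ ^ 2) → ∀ u,
      c / 32 * ‖u‖ ≤ empMean V (fun s => |inner ℝ u (W s)|) ω := by
  classical
  obtain ⟨G, hG, hPG, hdev⟩ := hV.exists_deviation_event hn ((netLevel N k).filter (‖·‖ ≤ 1))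
    (g := fun u s => |inner ℝ u (W s)|) (fun u _ => (h.measurable_inner u).abs)
    (κ := c / 2) (q := q) (b := 1) (M := 6 * Real.exp ((1 + 1) ^ 2 / c)) (by positivity) hq0
    one_pos (by positivity)
    (fun u hu => by
      rw [one_pow, one_mul]
      refine h.expMomentLE_abs hc (Finset.mem_filter.1 hu).2 ?_
      rw [div_one]; nlinarith) (2 * k + 3)
  refine ⟨G, hG, hPG.trans ?_, fun ω hω hsq u => ?_⟩
  · rw [hnq]
    refine card_mul_exp_le (j := k) ((Finset.card_filter_le _ _).trans
      ((card_netLevel_le N k).trans ?_)) le_rfl ht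
    rw [pow_mul]
    exact Nat.pow_le_pow_left hcard k
  have hmean : ∀ v, empMean V (fun s => |inner ℝ v (W s)|) ω ≤ 3 * ‖v‖ := by
    intro v
    have h1 := empMean_mul_sq_le (V := V) (g := fun s => |inner ℝ v (W s)|) (h := fun _ => 1)
      (ω := ω)
    have h2 : empMean V (fun _ => (1 : ℝ) ^ 2) ω = 1 := by
      have : (n : ℝ) ≠ 0 := by exact_mod_cast hn.ne'
      simp [empMean, this]
    simp only [mul_one, sq_abs, h2] at h1
    apply abs_le_of_sq_le_sq' _ (by positivity) |>.2
    nlinarith [hsq v, sq_nonneg ‖v‖]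
  have unit : ∀ u : Vec p, ‖u‖ = 1 → c / 32 ≤ empMean V (fun s => |inner ℝ u (W s)|) ω := by
    intro u hu
    have hp : (0 : ℝ) < (1 / 2) ^ k := by positivity
    -- Shrink `u` so that the approximating net point stays in the unit ball.
    obtain ⟨a, ha, hua⟩ := hN.exists_mem_netLevel (x := (1 - (1 / 2 : ℝ) ^ k) • u) (by
      rw [norm_smul, hu, Real.norm_of_nonneg (by linarith)]; linarith) k
    have hshrink : ‖(1 - (1 / 2 : ℝ) ^ k) • u‖ = 1 - (1 / 2 : ℝ) ^ k := by
      rw [norm_smul, hu, Real.norm_of_nonneg (by linarith), mul_one]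
    have ha1 : ‖a‖ ≤ 1 := by
      have := norm_le_norm_add_norm_sub ((1 - (1 / 2 : ℝ) ^ k) • u) a
      linarith
    have hdist : ‖u - a‖ ≤ 2 * (1 / 2 : ℝ) ^ k := by
      calc ‖u - a‖ = ‖((1 / 2 : ℝ) ^ k) • u + ((1 - (1 / 2 : ℝ) ^ k) • u - a)‖ := by
            congr 1; rw [sub_smul, one_smul]; abel
        _ ≤ (1 / 2 : ℝ) ^ k + (1 / 2 : ℝ) ^ k := by
            refine (norm_add_le _ _).trans (add_le_add ?_ hua)
            rw [norm_smul, hu, Real.norm_of_nonneg hp.le, mul_one]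
        _ = _ := by ring
    have ha2 : 1 / 2 ≤ ‖a‖ := by
      have := norm_le_norm_add_norm_sub a u
      rw [norm_sub_rev] at this
      linarith
    have h1 := (abs_le.1 (hdev ω hω a (Finset.mem_filter.2 ⟨ha, ha1⟩))).1
    have h2 := h.integral_abs_ge hc a
    have h3 : empMean V (fun s => |inner ℝ a (W s)|) ω ≤
        empMean V (fun s => |inner ℝ u (W s)|) ω +
          empMean V (fun s => |inner ℝ (u - a) (W s)|) ω := by
      rw [← empMean_add]
      refine empMean_mono fun s => ?_
      rw [inner_sub_left]
      have := abs_sub_abs_le_abs_sub (inner ℝ a (W s)) (inner ℝ u (W s))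
      rw [abs_sub_comm] at this
      linarith
    have h4 := hmean (u - a)
    rw [one_mul] at h1
    nlinarith
  rcases eq_or_ne u 0 with rfl | hu
  · simp [empMean]
  · have hpos : 0 < ‖u‖ := norm_pos_iff.2 hu
    have := unit (‖u‖⁻¹ • u) (by rw [norm_smul, norm_inv, norm_norm, inv_mul_cancel₀ hpos.ne'])
    simp only [real_inner_smul_left, abs_mul, empMean_const_mul, abs_inv, abs_norm] at this
    rw [le_inv_mul_iff₀ hpos] at this
    linarith

/-- Few observations have a score that is large at the true parameter. -/
lemma exists_event_score_large (h : WhitenedModel ρ W ξ c σ f) (hV : IsSample P ρ V) (hn : 0 < n)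
    (hc : 0 < c) (hc1 : c ≤ 1) (ht : 1 ≤ t) (hq0 : 0 ≤ q) (hq : q ≤ 1)
    (hnq : n * q ^ 2 = p + t) {τ : ℝ} (hτ : 0 < τ) :
    ∃ G : Set Ω, MeasurableSet G ∧ P.real Gᶜ ≤ Real.exp (-2 * t) ∧ ∀ ω ∈ G,
      empMean V (fun s => if |ξ 0 s| ≤ τ / 4 then 0 else 1) ω ≤
        16 * σ ^ 2 / τ ^ 2 + q * (3 / (c / 2) + c / 2 * 3) := by
  have hmξ := h.measurable_score 0
  have hmg : Measurable fun s => if |ξ 0 s| ≤ τ / 4 then (0 : ℝ) else 1 :=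
    Measurable.ite (measurableSet_le hmξ.abs measurable_const) measurable_const measurable_const
  have h01 : ∀ s, (if |ξ 0 s| ≤ τ / 4 then (0 : ℝ) else 1) = 0 ∨
      (if |ξ 0 s| ≤ τ / 4 then (0 : ℝ) else 1) = 1 := fun s => by split_ifs <;> simp
  obtain ⟨G, hG, hPG, hdev⟩ := hV.exists_deviation_event hn (Finset.univ : Finset Unit)
    (g := fun _ s => if |ξ 0 s| ≤ τ / 4 then 0 else 1) (fun _ _ => hmg)
    (κ := c / 2) (q := q) (b := 1) (M := 3) (by positivity) hq0
    one_pos (by positivity)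
    (fun _ _ => by
      have : ∀ s, (if |ξ 0 s| ≤ τ / 4 then (0 : ℝ) else 1) ^ 2 *
          Real.exp (c / 2 * q / 1 * |if |ξ 0 s| ≤ τ / 4 then (0 : ℝ) else 1|) ≤ 3 := by
        intro s
        rcases h01 s with h1 | h1 <;> rw [h1]
        · norm_num
        · have : Real.exp (c / 2 * q / 1 * |1|) ≤ Real.exp 1 := by
            apply Real.exp_le_exp.2
            rw [abs_one, div_one, mul_one]; nlinarith
          linarith [Real.exp_one_lt_d9]
      calc _ ≤ ∫⁻ _, ENNReal.ofReal 3 ∂ρ :=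
            lintegral_mono fun s => ENNReal.ofReal_le_ofReal (this s)
        _ = _ := by simp) 3
  refine ⟨G, hG, hPG.trans ?_, fun ω hω => ?_⟩
  · rw [hnq]; exact card_mul_exp_le (j := 0) (by simp) (by norm_num) ht
  have h1 := (abs_le.1 (hdev ω hω () (Finset.mem_univ _))).2
  obtain ⟨i2, h2⟩ := h.integrable_score_sq
  have h3 : ∫ s, (if |ξ 0 s| ≤ τ / 4 then (0 : ℝ) else 1) ∂ρ ≤ ∫ s, 16 / τ ^ 2 * ξ 0 s ^ 2 ∂ρ := by
    refine integral_mono ?_ (i2.const_mul _) fun s => ?_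
    · refine (integrable_const (1 : ℝ)).mono' hmg.aestronglyMeasurable
        (Filter.Eventually.of_forall fun s => ?_)
      rcases h01 s with h1 | h1 <;> rw [h1] <;> norm_num
    · simp only
      split_ifs with hs
      · positivity
      · push Not at hs
        rw [div_mul_eq_mul_div, le_div_iff₀ (by positivity), ← sq_abs (ξ 0 s)]
        nlinarith
  rw [integral_const_mul] at h3
  have h4 : 16 / τ ^ 2 * ∫ s, ξ 0 s ^ 2 ∂ρ ≤ 16 / τ ^ 2 * σ ^ 2 := by gcongr
  rw [one_mul] at h1
  rw [show 16 * σ ^ 2 / τ ^ 2 = 16 / τ ^ 2 * σ ^ 2 by ring]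
  linarith

lemma sum_range_geom_mul_le (K : ℕ) :
    ∑ k ∈ Finset.range K, (1 / 2 : ℝ) ^ k * (4 * k + 40) ≤ 88 := by
  have : ∀ K : ℕ, ∑ k ∈ Finset.range K, (1 / 2 : ℝ) ^ k * (4 * k + 40) =
      88 - (1 / 2 : ℝ) ^ K * (8 * K + 88) := by
    intro K
    induction K with
    | zero => norm_num
    | succ K ih => rw [Finset.sum_range_succ, ih, pow_succ]; push_cast; ring
  rw [this]
  have : (0 : ℝ) ≤ (1 / 2 : ℝ) ^ K * (8 * K + 88) := by positivity
  linarith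

/-- Chaining over the first-stage parameter: the centred empirical gradient of the Huberized loss
varies by at most a multiple of `r q` over the ball of radius `r`. -/
lemma exists_event_chaining (h : WhitenedModel ρ W ξ c σ f) (hV : IsSample P ρ V) (hn : 0 < n)
    (hc : 0 < c) (hN : IsHalfNet N) (hcard : N.card ≤ 5 ^ p) (ht : 1 ≤ t) (hq0 : 0 ≤ q)
    (hq : q ≤ 1) (hnq : n * q ^ 2 = p + t) {τ r : ℝ} (hτ : 0 < τ) (hr : 0 < r) :
    ∃ G : Set Ω, MeasurableSet G ∧ P.real Gᶜ ≤ Real.exp (-2 * t) ∧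
      ∀ ω ∈ G, ∀ u ∈ N, ∀ a : Vec p, ‖a‖ ≤ 1 →
      |(empMean V (fun s => clip τ (ξ (r • a) s) * inner ℝ u (W s)) ω -
          ∫ s, clip τ (ξ (r • a) s) * inner ℝ u (W s) ∂ρ) -
        (empMean V (fun s => clip τ (ξ 0 s) * inner ℝ u (W s)) ω -
          ∫ s, clip τ (ξ 0 s) * inner ℝ u (W s) ∂ρ)| ≤ 88 * r * q / c := by
  classical
  let g : Vec p → Vec p → S → ℝ := fun u a s => clip τ (ξ (r • a) s) * inner ℝ u (W s)
  have hgm : ∀ u a, Measurable (g u a) := fun u a => h.measurable_clip_mul τ _ u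
  have hgb : ∀ u a s, |g u a s| ≤ τ * |inner ℝ u (W s)| := fun u a s => by
    rw [abs_mul]; exact mul_le_mul_of_nonneg_right (abs_clip_le hτ.le _) (abs_nonneg _)
  have hgi : ∀ u a, Integrable (g u a) ρ := fun u a =>
    ((h.integrable_abs u).const_mul τ).mono' (hgm u a).aestronglyMeasurable
      (Filter.Eventually.of_forall (hgb u a))
  have level : ∀ k : ℕ, ∃ G : Set Ω, MeasurableSet G ∧
      P.real Gᶜ ≤ Real.exp (-2 * t) / 2 / 2 ^ k ∧
      ∀ ω ∈ G, ∀ i ∈ N ×ˢ netLevel N k ×ˢ N,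
        |empMean V (fun s => g i.1 (i.2.1 + (1 / 2 : ℝ) ^ k • i.2.2) s - g i.1 i.2.1 s) ω -
          ∫ s, (g i.1 (i.2.1 + (1 / 2 : ℝ) ^ k • i.2.2) s - g i.1 i.2.1 s) ∂ρ| ≤
        r * q / c * ((1 / 2 : ℝ) ^ k * (4 * k + 40)) := by
    intro k
    obtain ⟨G, hG, hPG, hdev⟩ := hV.exists_deviation_event hn (N ×ˢ netLevel N k ×ˢ N)
      (g := fun i s => g i.1 (i.2.1 + (1 / 2 : ℝ) ^ k • i.2.2) s - g i.1 i.2.1 s)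
      (fun i _ => (hgm _ _).sub (hgm _ _)) (κ := c / 2) (q := q) (b := r * (1 / 2) ^ k)
      (M := 48 / c ^ 2) (by positivity) hq0 (by positivity) (by positivity)
      (fun i hi => by
        simp only [Finset.mem_product] at hi
        refine h.expMomentLE_of_le_mul hc (hN.norm_le _ hi.2.2) (hN.norm_le _ hi.1) hq
          (by positivity) fun s => ?_
        simp only [g]
        rw [← sub_mul, abs_mul, ← mul_assoc]
        refine mul_le_mul_of_nonneg_right ((abs_clip_sub_clip_le _ _).trans
          ((h.lipschitz _ _ s).trans (le_of_eq ?_))) (abs_nonneg _)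
        rw [← smul_sub, add_sub_cancel_left, smul_smul, real_inner_smul_left, abs_mul,
          abs_of_pos (by positivity)]) (2 * k + 8)
    refine ⟨G, hG, hPG.trans ?_, fun ω hω i hi => (hdev ω hω i hi).trans (le_of_eq ?_)⟩
    · rw [hnq]
      have hcardk : (N ×ˢ netLevel N k ×ˢ N).card ≤ 5 ^ (p * (k + 2)) := by
        rw [Finset.card_product, Finset.card_product]
        calc N.card * ((netLevel N k).card * N.card)
            ≤ 5 ^ p * ((5 ^ p) ^ k * 5 ^ p) := by
              gcongr
              exact (card_netLevel_le N k).trans (Nat.pow_le_pow_left hcard k)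
          _ = 5 ^ (p * (k + 2)) := by ring
      -- Part of the exponent pays for the union over the levels.
      have h1 := card_mul_exp_le (w := 2 * k + 7) (t := t) hcardk (by push_cast; linarith) ht
      have hp : (0 : ℝ) ≤ p := Nat.cast_nonneg _
      have hk0 : (0 : ℝ) ≤ k := Nat.cast_nonneg _
      have h2 : ((N ×ˢ netLevel N k ×ˢ N).card : ℝ) * 2 ≤ 2 * Real.exp (2 * (p * (k + 2))) := by
        have : ((N ×ˢ netLevel N k ×ˢ N).card : ℝ) ≤ Real.exp (2 * ((p * (k + 2) : ℕ) : ℝ)) :=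
          le_trans (by exact_mod_cast hcardk) (five_pow_le_exp _)
        push_cast at this
        linarith
      have h3 : ((1 : ℝ) / 2) ^ (k + 1) ≥ Real.exp (-(k + 1)) := by
        have : Real.exp (-(k + 1 : ℝ)) = (Real.exp (-1)) ^ (k + 1) := by
          rw [← Real.exp_nat_mul]; congr 1; push_cast; ring
        rw [this]
        refine pow_le_pow_left₀ (Real.exp_pos _).le ?_ _
        rw [Real.exp_neg, one_div]
        exact inv_anti₀ (by norm_num) two_le_exp_one
      calc ((N ×ˢ netLevel N k ×ˢ N).card : ℝ) * (2 * Real.exp (-((2 * k + 8) * (p + t))))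
          = ((N ×ˢ netLevel N k ×ˢ N).card * 2) * Real.exp (-((2 * k + 8) * (p + t))) := by ring
        _ ≤ (Real.exp 1 * Real.exp (2 * (p * (k + 2)))) *
              Real.exp (-((2 * k + 8) * (p + t))) := by
            refine mul_le_mul_of_nonneg_right (h2.trans ?_) (Real.exp_pos _).le
            exact mul_le_mul_of_nonneg_right two_le_exp_one (Real.exp_pos _).le
        _ = Real.exp (1 + 2 * (p * (k + 2)) - (2 * k + 8) * (p + t)) := by
            rw [← Real.exp_add, ← Real.exp_add]; congr 1
        _ ≤ Real.exp (-2 * t + -(k + 1)) := by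
            apply Real.exp_le_exp.2
            nlinarith [mul_nonneg hk0 (sub_nonneg.2 ht)]
        _ ≤ Real.exp (-2 * t) * (1 / 2) ^ (k + 1) := by
            rw [Real.exp_add]; gcongr
        _ = _ := by rw [pow_succ, one_div, inv_pow]; ring
    · field_simp; ring
  choose G hGm hGP hGdev using level
  obtain ⟨hm, hP⟩ := exists_event_iInter hGm hGP (hasSum_geometric_two' (Real.exp (-2 * t)))
  refine ⟨_, hm, hP, fun ω hω u hu a ha => ?_⟩
  have hcont : Continuous fun a => empMean V (g u a) ω - ∫ s, g u a s ∂ρ := by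
    have hpt : ∀ s, Continuous fun a => g u a s := fun s =>
      (continuous_clip.comp ((h.continuous_score s).comp (continuous_const_smul r))).mul
        continuous_const
    refine Continuous.sub ?_ ?_
    · unfold empMean
      exact continuous_const.mul (continuous_finsetSum _ fun i _ => hpt _)
    · exact continuous_of_dominated (fun a => (hgm u a).aestronglyMeasurable)
        (fun a => Filter.Eventually.of_forall (hgb u a)) ((h.integrable_abs u).const_mul τ)
        (Filter.Eventually.of_forall hpt)
  have key := hN.abs_sub_le_of_links hcont
    (T := fun k => r * q / c * ((1 / 2 : ℝ) ^ k * (4 * k + 40))) (S := 88 * r * q / c)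
    (fun K => by
      rw [← Finset.mul_sum]
      have := mul_le_mul_of_nonneg_left (sum_range_geom_mul_le K)
        (by positivity : 0 ≤ r * q / c)
      calc _ ≤ _ := this
        _ = _ := by ring)
    (fun k b hb d hd => by
      have := hGdev k ω (mem_iInter.1 hω k) (u, b, d)
        (Finset.mem_product.2 ⟨hu, Finset.mem_product.2 ⟨hb, hd⟩⟩)
      simp only at this
      rw [empMean_sub, integral_sub (hgi _ _) (hgi _ _)] at this
      convert this using 2
      ring) ha
  simpa [g] using key

/-- Uniformly over the first-stage parameter, the gradient of the empirical Huberized loss at the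
true second-stage parameter is small. -/
lemma exists_event_gradient_le (h : WhitenedModel ρ W ξ c σ f) (hV : IsSample P ρ V) (hn : 0 < n)
    (hc : 0 < c) (hc1 : c ≤ 1) (hσ : 0 < σ) (hf : 0 ≤ f) (hN : IsHalfNet N)
    (hcard : N.card ≤ 5 ^ p) (ht : 1 ≤ t)
    (hq0 : 0 ≤ q) (hq : q ≤ 1) (hnq : n * q ^ 2 = p + t) {τ r D : ℝ} (hτ : 0 < τ) (hr : 0 < r)
    (hτD : q * τ ≤ D * σ) :
    ∃ G : Set Ω, MeasurableSet G ∧ P.real Gᶜ ≤ 2 * Real.exp (-2 * t) ∧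
      ∀ ω ∈ G, ∀ η : Vec p, ‖η‖ ≤ r → ∀ u : Vec p,
      |empMean V (fun s => clip τ (ξ η s) * inner ℝ u (W s)) ω| ≤
        2 * (88 * r * q / c + σ * q * (5 / (c / 2) + c / 2 * (6 * Real.exp ((1 + D) ^ 2 / c))) +
          ((6 / c ^ 2 + 1) * (f * r ^ 2) + (2 * σ ^ 2 + 2 * (6 / c ^ 2 + 1) * r ^ 2) / τ)) *
        ‖u‖ := by
  obtain ⟨G₁, hG₁, hP₁, hdev₁⟩ :=
    h.exists_event_chaining hV hn hc hN hcard ht hq0 hq hnq hτ hr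
  obtain ⟨G₂, hG₂, hP₂, hdev₂⟩ := hV.exists_deviation_event hn N
    (g := fun u s => clip τ (ξ 0 s) * inner ℝ u (W s)) (fun u _ => h.measurable_clip_mul τ 0 u)
    (κ := c / 2) (q := q) (b := σ) (M := 6 * Real.exp ((1 + D) ^ 2 / c)) (by positivity) hq0
    hσ (by positivity)
    (fun u hu => h.expMomentLE_clip_mul hc (hN.norm_le u hu) (by positivity) hτ.le (by
      rw [div_mul_eq_mul_div, div_le_iff₀ hσ]
      nlinarith [mul_nonneg hq0 hτ.le])) 5
  refine ⟨G₁ ∩ G₂, hG₁.inter hG₂, ?_, fun ω hω η hη u => ?_⟩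
  · rw [compl_inter]
    refine (measureReal_union_le _ _).trans ?_
    have : P.real G₂ᶜ ≤ Real.exp (-2 * t) := by
      refine hP₂.trans ?_
      rw [hnq]; exact card_mul_exp_le (j := 1) (by simpa using hcard) (by norm_num) ht
    linarith
  have hηa : r • (r⁻¹ • η) = η := smul_inv_smul₀ hr.ne' η
  have ha : ‖r⁻¹ • η‖ ≤ 1 := by
    rw [norm_smul, norm_inv, Real.norm_of_nonneg hr.le, inv_mul_le_iff₀ hr]; linarith
  have hlin : ∀ v, empMean V (fun s => clip τ (ξ η s) * inner ℝ v (W s)) ω =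
      innerSL ℝ ((1 / (n : ℝ)) • ∑ i, clip τ (ξ η (V i ω)) • W (V i ω)) v := by
    intro v
    simp only [empMean, innerSL_apply_apply, real_inner_smul_left, sum_inner]
    simp only [real_inner_comm]
  rw [hlin, ← Real.norm_eq_abs]
  refine hN.norm_apply_le _ (fun v hv => ?_) u
  rw [Real.norm_eq_abs, ← hlin]
  have h1 := hdev₁ ω hω.1 v hv _ ha
  have h2 := hdev₂ ω hω.2 v hv
  have h3 := h.abs_integral_clip_mul_le hc hf hτ (r := r) ha (hN.norm_le v hv)
  rw [hηa] at h1 h3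
  rw [abs_le] at *
  constructor <;> linarith [h1.1, h1.2, h2.1, h2.2, h3.1, h3.2]

end WhitenedModel

/-! ### Curvature, localization, and the bound in whitened coordinates -/

section Curvature

variable {S Ω : Type*} {n p : ℕ} {W : S → Vec p} {ξ : Vec p → S → ℝ} {V : Fin n → Ω → S} {ω : Ω}
  {c τ : ℝ}

/-- The indicator of the observations at which the Huber loss is quadratic along the step `δ`. -/
def quadIndicator (W : S → Vec p) (ξ : Vec p → S → ℝ) (τ : ℝ) (η δ : Vec p) (s : S) : ℝ :=
  if |ξ 0 s| ≤ τ / 4 ∧ |inner ℝ η (W s)| ≤ τ / 4 ∧ |inner ℝ δ (W s)| ≤ τ / 2 then 1 else 0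

/-- The quadratic part of the Huberized loss is bounded below. The observations at which the loss is
not quadratic are few, so by the Cauchy–Schwarz inequality they carry only a small part of the first
absolute moment. -/
lemma empMean_quadIndicator_mul_ge (hn : 0 < n) (hc : 0 < c) (hτ : 0 < τ)
    (hsq : ∀ u, empMean V (fun s => inner ℝ u (W s) ^ 2) ω ≤ 8 * ‖u‖ ^ 2)
    (habs : ∀ u, c / 32 * ‖u‖ ≤ empMean V (fun s => |inner ℝ u (W s)|) ω) {A : ℝ}
    (hlarge : empMean V (fun s => if |ξ 0 s| ≤ τ / 4 then 0 else 1) ω ≤ A) {η δ : Vec p}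
    (hsmall : 8 * (A + 128 * ‖η‖ ^ 2 / τ ^ 2 + 32 * ‖δ‖ ^ 2 / τ ^ 2) ≤ (c / 64) ^ 2) :
    (c / 64) ^ 2 * ‖δ‖ ^ 2 ≤
      empMean V (fun s => quadIndicator W ξ τ η δ s * inner ℝ δ (W s) ^ 2) ω := by
  let I : S → ℝ := quadIndicator W ξ τ η δ
  have hI : ∀ s, I s = 0 ∨ I s = 1 := fun s => by
    simp only [I, quadIndicator]; split_ifs <;> simp
  have hbad : empMean V (fun s => (1 - I s) ^ 2) ω ≤
      A + 128 * ‖η‖ ^ 2 / τ ^ 2 + 32 * ‖δ‖ ^ 2 / τ ^ 2 := by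
    have h1 : empMean V (fun s => (1 - I s) ^ 2) ω ≤
        empMean V (fun s => (if |ξ 0 s| ≤ τ / 4 then 0 else 1) +
          (16 / τ ^ 2 * inner ℝ η (W s) ^ 2 + 4 / τ ^ 2 * inner ℝ δ (W s) ^ 2)) ω := by
      refine empMean_mono fun s => ?_
      have p1 : 0 ≤ 16 / τ ^ 2 * inner ℝ η (W s) ^ 2 := by positivity
      have p2 : 0 ≤ 4 / τ ^ 2 * inner ℝ δ (W s) ^ 2 := by positivity
      by_cases c1 : |ξ 0 s| ≤ τ / 4
      · by_cases c2 : |inner ℝ η (W s)| ≤ τ / 4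
        · by_cases c3 : |inner ℝ δ (W s)| ≤ τ / 2
          · simp only [I, quadIndicator, c1, c2, c3, and_self, if_true]
            linarith
          · have : 1 ≤ 4 / τ ^ 2 * inner ℝ δ (W s) ^ 2 := by
              push Not at c3
              rw [div_mul_eq_mul_div, le_div_iff₀ (by positivity), ← sq_abs (inner ℝ δ (W s))]
              nlinarith
            simp only [I, quadIndicator, c1, c2, c3, and_false, if_false, if_true]
            linarith
        · have : 1 ≤ 16 / τ ^ 2 * inner ℝ η (W s) ^ 2 := by
            push Not at c2
            rw [div_mul_eq_mul_div, le_div_iff₀ (by positivity), ← sq_abs (inner ℝ η (W s))]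
            nlinarith
          simp only [I, quadIndicator, c1, c2, and_false, false_and, if_false, if_true]
          linarith
      · simp only [I, quadIndicator, c1, false_and, if_false]
        linarith
    refine h1.trans ?_
    rw [empMean_add, empMean_add, empMean_const_mul, empMean_const_mul]
    have h2 : 16 / τ ^ 2 * empMean V (fun s => inner ℝ η (W s) ^ 2) ω ≤
        16 / τ ^ 2 * (8 * ‖η‖ ^ 2) := by gcongr; exact hsq η
    have h3 : 4 / τ ^ 2 * empMean V (fun s => inner ℝ δ (W s) ^ 2) ω ≤
        4 / τ ^ 2 * (8 * ‖δ‖ ^ 2) := by gcongr; exact hsq δ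
    have e2 : 16 / τ ^ 2 * (8 * ‖η‖ ^ 2) = 128 * ‖η‖ ^ 2 / τ ^ 2 := by ring
    have e3 : 4 / τ ^ 2 * (8 * ‖δ‖ ^ 2) = 32 * ‖δ‖ ^ 2 / τ ^ 2 := by ring
    linarith
  -- the share of the bad observations in the first absolute moment
  have hb : empMean V (fun s => (1 - I s) * |inner ℝ δ (W s)|) ω ≤ c / 64 * ‖δ‖ := by
    have h1 := empMean_mul_sq_le (V := V) (g := fun s => 1 - I s)
      (h := fun s => |inner ℝ δ (W s)|) (ω := ω)
    simp only [sq_abs] at h1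
    apply abs_le_of_sq_le_sq' _ (by positivity) |>.2
    refine h1.trans ?_
    have h2 : 0 ≤ empMean V (fun s => (1 - I s) ^ 2) ω := empMean_nonneg fun s => sq_nonneg _
    calc _ ≤ empMean V (fun s => (1 - I s) ^ 2) ω * (8 * ‖δ‖ ^ 2) :=
          mul_le_mul_of_nonneg_left (hsq δ) h2
      _ ≤ (c / 64 * ‖δ‖) ^ 2 := by nlinarith [sq_nonneg ‖δ‖]
  have hg : c / 64 * ‖δ‖ ≤ empMean V (fun s => I s * |inner ℝ δ (W s)|) ω := by
    have h1 := habs δ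
    have h2 : empMean V (fun s => |inner ℝ δ (W s)|) ω =
        empMean V (fun s => I s * |inner ℝ δ (W s)|) ω +
          empMean V (fun s => (1 - I s) * |inner ℝ δ (W s)|) ω := by
      rw [← empMean_add]; congr 1; ext s; ring
    linarith
  have h1 := empMean_mul_sq_le (V := V) (g := fun s => I s * |inner ℝ δ (W s)|)
    (h := fun _ => 1) (ω := ω)
  have h2 : empMean V (fun _ => (1 : ℝ) ^ 2) ω = 1 := by
    have : (n : ℝ) ≠ 0 := by exact_mod_cast hn.ne'
    simp [empMean, this]
  have h3 : (fun s => (I s * |inner ℝ δ (W s)|) ^ 2) =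
      fun s => quadIndicator W ξ τ η δ s * inner ℝ δ (W s) ^ 2 := by
    ext s
    rw [mul_pow, sq_abs]
    rcases hI s with h | h <;> simp only [I] at h <;> simp [I, h]
  rw [h2, h3] at h1
  simp only [mul_one] at h1
  refine le_trans ?_ h1
  rw [← mul_pow]
  exact pow_le_pow_left₀ (by positivity) hg 2

/-- Localization: a minimizer of the empirical Huberized loss cannot lie beyond a sphere on which
the curvature dominates the gradient. -/
lemma norm_le_of_isMinimizer (hτ : 0 < τ)
    (hlip : ∀ η s, |ξ η s - ξ 0 s| ≤ |inner ℝ η (W s)|) {η δ : Vec p} {a k R : ℝ}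
    (hR : 0 < R) (haR : a < k / 2 * R)
    (hgrad : ∀ u, |empMean V (fun s => clip τ (ξ η s) * inner ℝ u (W s)) ω| ≤ a * ‖u‖)
    (hquad : ∀ u : Vec p, ‖u‖ = R →
      k * ‖u‖ ^ 2 ≤ empMean V (fun s => quadIndicator W ξ τ η u s * inner ℝ u (W s) ^ 2) ω)
    (hmin : ∀ δ', empMean V (fun s => huber τ (ξ η s + inner ℝ δ (W s))) ω ≤
      empMean V (fun s => huber τ (ξ η s + inner ℝ δ' (W s))) ω) : ‖δ‖ ≤ R := by
  by_contra hcon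
  push Not at hcon
  have hδ : 0 < ‖δ‖ := hR.trans hcon
  set l : ℝ := R / ‖δ‖ with hl
  have hl0 : 0 < l := div_pos hR hδ
  have hl1 : l ≤ 1 := (div_le_one hδ).2 hcon.le
  have hu : ‖l • δ‖ = R := by
    rw [norm_smul, Real.norm_of_nonneg hl0.le, hl, div_mul_cancel₀ _ hδ.ne']
  let L : Vec p → ℝ := fun d => empMean V (fun s => huber τ (ξ η s + inner ℝ d (W s))) ω
  have hconv : L (l • δ) ≤ L 0 := by
    have h1 : L (l • δ) ≤ (1 - l) * L 0 + l * L δ := by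
      simp only [L]
      rw [← empMean_const_mul, ← empMean_const_mul, ← empMean_add]
      refine empMean_mono fun s => ?_
      rw [real_inner_smul_left, inner_zero_left, add_zero]
      exact huber_convex hτ _ _ hl0.le hl1
    have h2 : L δ ≤ L 0 := hmin 0
    nlinarith
  have hgrow : L 0 + (empMean V (fun s => clip τ (ξ η s) * inner ℝ (l • δ) (W s)) ω +
      1 / 2 * empMean V (fun s => quadIndicator W ξ τ η (l • δ) s * inner ℝ (l • δ) (W s) ^ 2) ω) ≤
      L (l • δ) := by
    simp only [L]
    rw [← empMean_const_mul, ← empMean_add, ← empMean_add]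
    refine empMean_mono fun s => ?_
    rw [inner_zero_left, add_zero, ← add_assoc]
    refine le_trans (add_le_add le_rfl ?_) (huber_add_ge hτ _ _)
    by_cases hs : |ξ 0 s| ≤ τ / 4 ∧ |inner ℝ η (W s)| ≤ τ / 4 ∧ |inner ℝ (l • δ) (W s)| ≤ τ / 2
    · have h1 : |ξ η s| ≤ τ / 2 := by
        have h2 := abs_sub_abs_le_abs_sub (ξ η s) (ξ 0 s)
        linarith [hlip η s, hs.1, hs.2.1]
      rw [quadIndicator, if_pos hs, if_pos ⟨h1, hs.2.2⟩]
      linarith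
    · rw [quadIndicator, if_neg hs]
      split_ifs
      · nlinarith [sq_nonneg (inner ℝ (l • δ) (W s))]
      · simp
  have h1 := (abs_le.1 (hgrad (l • δ))).1
  have h2 := hquad (l • δ) hu
  rw [hu] at h1 h2
  nlinarith

end Curvature

/-- The deviation bound in whitened coordinates, at the rate `σ q` with `q = √((p + t) / n)`. -/
theorem WhitenedModel.exists_const_norm_le {c cτ Cτ K₁ K₂ : ℝ} (hc : 0 < c) (hc1 : c ≤ 1)
    (hcτ : 0 < cτ) (hK₁ : 0 < K₁) (hK₂ : 0 < K₂) :
    ∃ C q₀ : ℝ, 0 < C ∧ 0 < q₀ ∧ ∀ (n p : ℕ) (σ f t r τ q : ℝ), 0 < σ → 0 ≤ f → 1 ≤ t → 0 < r →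
      0 < q → q ≤ q₀ → n * q ^ 2 = p + t → r ≤ K₁ * σ → f * r ^ 2 ≤ K₂ * (σ * q) →
      cτ * σ ≤ q * τ → q * τ ≤ Cτ * σ →
      ∀ {S Ω : Type*} [MeasurableSpace S] [MeasurableSpace Ω] (ρ : Measure S)
        [IsProbabilityMeasure ρ] (P : Measure Ω) [IsProbabilityMeasure P] (W : S → Vec p)
        (ξ : Vec p → S → ℝ) (V : Fin n → Ω → S), WhitenedModel ρ W ξ c σ f → IsSample P ρ V →
      ∃ G : Set Ω, MeasurableSet G ∧ P.real Gᶜ ≤ 5 * Real.exp (-2 * t) ∧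
        ∀ ω ∈ G, ∀ η : Vec p, ‖η‖ ≤ r → ∀ δ : Vec p,
          (∀ δ', empMean V (fun s => huber τ (ξ η s + inner ℝ δ (W s))) ω ≤
            empMean V (fun s => huber τ (ξ η s + inner ℝ δ' (W s))) ω) →
          ‖δ‖ ≤ C * (σ * q) := by
  obtain ⟨j, hj⟩ := exists_pow_lt_of_lt_one (show 0 < c / 384 by positivity)
    (show (1 / 2 : ℝ) < 1 by norm_num)
  -- `a` bounds the gradient in units of `σ q`
  set a : ℝ := 2 * (88 * K₁ / c + (5 / (c / 2) + c / 2 * (6 * Real.exp ((1 + Cτ) ^ 2 / c))) +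
    ((6 / c ^ 2 + 1) * K₂ + (2 + 2 * (6 / c ^ 2 + 1) * K₁ ^ 2) / cτ)) with ha
  have ha0 : 0 < a := by positivity
  set C : ℝ := 4 * a / (c / 64) ^ 2 with hC
  have hC0 : 0 < C := by positivity
  set B₁ : ℝ := (2 * j + 3) / (c / 2) + c / 2 * (6 * Real.exp ((1 + 1) ^ 2 / c)) with hB₁
  have hB₁0 : 0 < B₁ := by positivity
  -- `B₂ q` bounds the proportion of observations outside the quadratic regime
  set B₂ : ℝ := 16 / cτ ^ 2 + (3 / (c / 2) + c / 2 * 3) + 128 * K₁ ^ 2 / cτ ^ 2 +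
    32 * C ^ 2 / cτ ^ 2 with hB₂
  have hB₂0 : 0 < B₂ := by positivity
  refine ⟨C, min 1 (min (c / 34) (min (c / 64 / B₁) ((c / 64) ^ 2 / 8 / B₂))), hC0, by positivity,
    ?_⟩
  intro n p σ f t r τ q hσ hf ht hr hq0 hq hnq hrK hfr hτ1 hτ2 S Ω _ _ ρ _ P _ W ξ V h hV
  have hq1 : q ≤ 1 := hq.trans (min_le_left _ _)
  have hq2 : q * (34 / c) ≤ 1 := by
    have : q ≤ c / 34 := hq.trans ((min_le_right _ _).trans (min_le_left _ _))
    rw [mul_div_assoc', div_le_one hc]; linarith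
  have hq3 : q * B₁ ≤ c / 64 := by
    rw [← le_div_iff₀ hB₁0]
    exact hq.trans ((min_le_right _ _).trans ((min_le_right _ _).trans (min_le_left _ _)))
  have hq4 : q * B₂ ≤ (c / 64) ^ 2 / 8 := by
    rw [← le_div_iff₀ hB₂0]
    exact hq.trans ((min_le_right _ _).trans ((min_le_right _ _).trans (min_le_right _ _)))
  have hτ : 0 < τ := by
    by_contra hneg
    push Not at hneg
    have : 0 < cτ * σ := by positivity
    nlinarith
  have hn : 0 < n := by
    rcases Nat.eq_zero_or_pos n with rfl | hn
    · have : (0 : ℝ) ≤ p := Nat.cast_nonneg _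
      simp at hnq
      linarith
    · exact hn
  obtain ⟨N, hN, hcard⟩ := exists_isHalfNet (E := Vec p)
  rw [finrank_euclideanSpace_fin] at hcard
  obtain ⟨G₁, hG₁, hP₁, H₁⟩ := h.exists_event_sq_le hV hn hc hN hcard ht hq0.le hq1 hnq hq2
  obtain ⟨G₂, hG₂, hP₂, H₂⟩ := h.exists_event_abs_ge hV hn hc hc1 hN hcard ht hq0.le hq1 hnq
    (k := j) (by linarith) hq3
  obtain ⟨G₃, hG₃, hP₃, H₃⟩ := h.exists_event_score_large hV hn hc hc1 ht hq0.le hq1 hnq hτ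
  obtain ⟨G₄, hG₄, hP₄, H₄⟩ := h.exists_event_gradient_le hV hn hc hc1 hσ hf hN hcard ht hq0.le hq1
    hnq hτ hr hτ2
  refine ⟨G₁ ∩ G₂ ∩ G₃ ∩ G₄, ((hG₁.inter hG₂).inter hG₃).inter hG₄, ?_, ?_⟩
  · rw [compl_inter, compl_inter, compl_inter]
    have e1 := measureReal_union_le (μ := P) (G₁ᶜ ∪ G₂ᶜ ∪ G₃ᶜ) G₄ᶜ
    have e2 := measureReal_union_le (μ := P) (G₁ᶜ ∪ G₂ᶜ) G₃ᶜ
    have e3 := measureReal_union_le (μ := P) G₁ᶜ G₂ᶜ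
    linarith
  rintro ω ⟨⟨⟨hω1, hω2⟩, hω3⟩, hω4⟩ η hη δ hmin
  have hστ : σ / τ ≤ q / cτ := by
    rw [div_le_div_iff₀ hτ hcτ]; linarith
  have hστ2 : σ ^ 2 / τ ^ 2 ≤ q / cτ ^ 2 := by
    rw [← div_pow]
    calc (σ / τ) ^ 2 ≤ (q / cτ) ^ 2 := by gcongr
      _ = q * q / cτ ^ 2 := by ring
      _ ≤ q * 1 / cτ ^ 2 := by gcongr
      _ = _ := by rw [mul_one]
  have hr2 : r ^ 2 ≤ K₁ ^ 2 * σ ^ 2 := by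
    rw [← mul_pow]; exact pow_le_pow_left₀ hr.le hrK 2
  refine norm_le_of_isMinimizer hτ (fun η s => by simpa using h.lipschitz η 0 s)
    (a := a * (σ * q)) (k := (c / 64) ^ 2) (by positivity) ?_ (fun u => ?_) (fun u hu => ?_) hmin
  · have : (c / 64) ^ 2 / 2 * (C * (σ * q)) = 2 * (a * (σ * q)) := by
      rw [hC]; field_simp; norm_num
    rw [this]
    have : 0 < a * (σ * q) := by positivity
    linarith
  · refine (H₄ ω hω4 η hη u).trans (mul_le_mul_of_nonneg_right ?_ (norm_nonneg _))
    have e1 : 88 * r * q / c ≤ 88 * K₁ / c * (σ * q) := by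
      calc 88 * r * q / c ≤ 88 * (K₁ * σ) * q / c := by gcongr
        _ = _ := by ring
    have e2 : (6 / c ^ 2 + 1) * (f * r ^ 2) ≤ (6 / c ^ 2 + 1) * (K₂ * (σ * q)) := by gcongr
    have e3 : (2 * σ ^ 2 + 2 * (6 / c ^ 2 + 1) * r ^ 2) / τ ≤
        (2 + 2 * (6 / c ^ 2 + 1) * K₁ ^ 2) / cτ * (σ * q) := by
      calc (2 * σ ^ 2 + 2 * (6 / c ^ 2 + 1) * r ^ 2) / τ
          ≤ (2 * σ ^ 2 + 2 * (6 / c ^ 2 + 1) * (K₁ ^ 2 * σ ^ 2)) / τ := by gcongr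
        _ = (2 + 2 * (6 / c ^ 2 + 1) * K₁ ^ 2) * σ * (σ / τ) := by ring
        _ ≤ (2 + 2 * (6 / c ^ 2 + 1) * K₁ ^ 2) * σ * (q / cτ) := by gcongr
        _ = _ := by ring
    rw [ha]
    linarith
  · refine empMean_quadIndicator_mul_ge hn hc hτ (H₁ ω hω1) (H₂ ω hω2 (H₁ ω hω1)) (H₃ ω hω3) ?_
    have f1 : 16 * σ ^ 2 / τ ^ 2 ≤ 16 / cτ ^ 2 * q := by
      calc 16 * σ ^ 2 / τ ^ 2 = 16 * (σ ^ 2 / τ ^ 2) := by ring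
        _ ≤ 16 * (q / cτ ^ 2) := by gcongr
        _ = _ := by ring
    have f2 : 128 * ‖η‖ ^ 2 / τ ^ 2 ≤ 128 * K₁ ^ 2 / cτ ^ 2 * q := by
      calc 128 * ‖η‖ ^ 2 / τ ^ 2 ≤ 128 * (K₁ ^ 2 * σ ^ 2) / τ ^ 2 := by
            have : ‖η‖ ^ 2 ≤ K₁ ^ 2 * σ ^ 2 :=
              (pow_le_pow_left₀ (norm_nonneg _) hη 2).trans hr2
            gcongr
        _ = 128 * K₁ ^ 2 * (σ ^ 2 / τ ^ 2) := by ring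
        _ ≤ 128 * K₁ ^ 2 * (q / cτ ^ 2) := by gcongr
        _ = _ := by ring
    have f3 : 32 * ‖u‖ ^ 2 / τ ^ 2 ≤ 32 * C ^ 2 / cτ ^ 2 * q := by
      calc 32 * ‖u‖ ^ 2 / τ ^ 2 ≤ 32 * (C * (σ * 1)) ^ 2 / τ ^ 2 := by rw [hu]; gcongr
        _ = 32 * C ^ 2 * (σ ^ 2 / τ ^ 2) := by ring
        _ ≤ 32 * C ^ 2 * (q / cτ ^ 2) := by gcongr
        _ = _ := by ring
    rw [hB₂] at hq4
    linarith

/-! ### Whitening -/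

section Whitening

variable {p : ℕ} {A : Matrix (Fin p) (Fin p) ℝ}

/-- `A^{1/2} b`, the inverse of whitening. -/
def color (A : Matrix (Fin p) (Fin p) ℝ) (b : Vec p) : Vec p :=
  WithLp.toLp 2 (CFC.sqrt A *ᵥ b.ofLp)

lemma sqrt_mul_sqrt (hA : A.PosDef) : CFC.sqrt A * CFC.sqrt A = A :=
  CFC.sqrt_mul_sqrt_self A (Matrix.nonneg_iff_posSemidef.2 hA.posSemidef)

lemma transpose_sqrt : (CFC.sqrt A)ᵀ = CFC.sqrt A := by
  have := (Matrix.nonneg_iff_posSemidef.1 (CFC.sqrt_nonneg A)).isHermitian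
  simpa [Matrix.IsHermitian, Matrix.conjTranspose_eq_transpose_of_trivial] using this

lemma isUnit_det_sqrt (hA : A.PosDef) : IsUnit (CFC.sqrt A).det := by
  have h := congrArg Matrix.det (sqrt_mul_sqrt hA)
  rw [Matrix.det_mul] at h
  refine isUnit_iff_ne_zero.2 fun h0 => hA.det_pos.ne' ?_
  rw [← h, h0, zero_mul]

lemma norm_color (hA : A.PosDef) (b : Vec p) : ‖color A b‖ = matNorm A b := by
  rw [matNorm, EuclideanSpace.norm_eq]
  congr 1
  have h : b.ofLp ⬝ᵥ (A *ᵥ b.ofLp) = (CFC.sqrt A *ᵥ b.ofLp) ⬝ᵥ (CFC.sqrt A *ᵥ b.ofLp) := by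
    conv_lhs => rw [← sqrt_mul_sqrt hA]
    rw [← Matrix.mulVec_mulVec, Matrix.dotProduct_mulVec, ← Matrix.mulVec_transpose,
      transpose_sqrt]
  rw [h]
  simp [color, dotProduct, sq]

lemma inner_color_whiten (hA : A.PosDef) (b x : Vec p) :
    inner ℝ (color A b) (whiten A x) = inner ℝ x b := by
  simp only [color, whiten, EuclideanSpace.inner_eq_star_dotProduct, star_trivial]
  rw [Matrix.dotProduct_mulVec, ← Matrix.mulVec_transpose, transpose_sqrt, Matrix.mulVec_mulVec,
    Matrix.mul_nonsing_inv _ (isUnit_det_sqrt hA), Matrix.one_mulVec, dotProduct_comm]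

lemma exists_color_eq (hA : A.PosDef) (η : Vec p) : ∃ b, color A b = η := by
  refine ⟨whiten A η, ?_⟩
  simp only [color, whiten]
  rw [Matrix.mulVec_mulVec, Matrix.mul_nonsing_inv _ (isUnit_det_sqrt hA), Matrix.one_mulVec]

lemma color_smul (a : ℝ) (b : Vec p) : color A (a • b) = a • color A b := by
  simp [color, Matrix.mulVec_smul]

lemma measurable_whiten : Measurable (whiten A) := by
  unfold whiten
  have : Continuous fun x : Vec p => WithLp.toLp 2 ((CFC.sqrt A)⁻¹ *ᵥ x.ofLp) := by fun_prop
  exact this.measurable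

lemma integral_inner_sq {μ : Measure (Vec p)} (h : MemLp (fun x : Vec p => x) 2 μ) (b : Vec p) :
    ∫ x, inner ℝ x b ^ 2 ∂μ = b.ofLp ⬝ᵥ (secondMoment μ *ᵥ b.ofLp) := by
  have hc : ∀ j, MemLp (fun x : Vec p => x j) 2 μ := fun j =>
    h.mono (by fun_prop) (Filter.Eventually.of_forall fun x => PiLp.norm_apply_le x j)
  have hi : ∀ j k, Integrable (fun x : Vec p => x j * x k) μ := fun j k =>
    (hc j).integrable_mul (hc k)
  have e : ∀ x : Vec p, inner ℝ x b ^ 2 = ∑ j, ∑ k, b j * b k * (x j * x k) := by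
    intro x
    rw [PiLp.inner_apply, sq, Finset.sum_mul_sum]
    refine Finset.sum_congr rfl fun j _ => Finset.sum_congr rfl fun k _ => ?_
    simp only [RCLike.inner_apply, conj_trivial]
    ring
  simp_rw [e]
  rw [integral_finsetSum _ fun j _ => integrable_finsetSum _ fun k _ => (hi j k).const_mul _]
  simp only [dotProduct, Matrix.mulVec, secondMoment, Matrix.of_apply, Finset.mul_sum]
  refine Finset.sum_congr rfl fun j _ => ?_
  rw [integral_finsetSum _ fun k _ => (hi j k).const_mul _]
  refine Finset.sum_congr rfl fun k _ => ?_
  rw [integral_const_mul]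
  ring

end Whitening

/-! ### Conditional moments of the orthogonal score -/

section Conditional

variable {ν : Measure ℝ} {α e f m σ : ℝ}

lemma max_sub_eq_indicator (m : ℝ) :
    (fun y => max (m - y) 0) = (Iic m).indicator fun y => m - y := by
  ext y
  by_cases hy : y ≤ m
  · rw [indicator_of_mem (mem_Iic.2 hy), max_eq_left (by linarith)]
  · rw [indicator_of_notMem (by simpa using hy), max_eq_right (by linarith)]

/-- The conditional second moment of the score at the true parameter. -/
lemma lintegral_score_sq_le (hi : ∫ y, max (m - y) 0 ∂ν = α * (m - e))
    (hv : evariance (fun z : ℝ => min z 0) (ν.map fun y => y - m) ≤ ENNReal.ofReal (σ ^ 2)) :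
    ∫⁻ y, ENNReal.ofReal ((max (m - y) 0 + α * (e - m)) ^ 2) ∂ν ≤ ENNReal.ofReal (σ ^ 2) := by
  have hmin : ∀ y, min (y - m) 0 = -max (m - y) 0 := fun y => by
    rw [← min_neg_neg]; simp
  have hmean : ∫ z, min z 0 ∂(ν.map fun y => y - m) = α * (e - m) := by
    rw [integral_map (by fun_prop) (by fun_prop)]
    simp_rw [hmin]
    rw [integral_neg, hi]
    ring
  rw [evariance, hmean, lintegral_map (by fun_prop) (by fun_prop)] at hv
  refine le_trans (lintegral_mono fun y => ?_) hv
  rw [hmin, Real.enorm_eq_ofReal_abs, ← ENNReal.ofReal_pow (abs_nonneg _), sq_abs]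
  apply ENNReal.ofReal_le_ofReal
  apply le_of_eq
  ring

variable [IsProbabilityMeasure ν]

lemma measureReal_Iic_quantile (hα : 0 < α) (hα1 : α < 1)
    (hcont : Continuous fun y => ν.real (Iic y)) : ν.real (Iic (quantile ν α)) = α := by
  set s := {y : ℝ | α ≤ ν.real (Iic y)} with hs
  have hcdf : ∀ y, ν.real (Iic y) = cdf ν y := fun y => (cdf_eq_real ν y).symm
  have hne : s.Nonempty := by
    have := (tendsto_cdf_atTop ν).eventually (eventually_gt_nhds hα1)
    obtain ⟨y, hy⟩ := this.exists
    exact ⟨y, by rw [hs, mem_ofPred_eq, hcdf]; exact hy.le⟩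
  have hbdd : BddBelow s := by
    have := (tendsto_cdf_atBot ν).eventually (eventually_lt_nhds hα)
    obtain ⟨y, hy⟩ := this.exists
    refine ⟨y, fun z hz => ?_⟩
    by_contra hlt
    push Not at hlt
    rw [hs, mem_ofPred_eq, hcdf] at hz
    linarith [monotone_cdf ν hlt.le]
  have hclosed : IsClosed s := isClosed_le continuous_const hcont
  apply le_antisymm
  · have hlim : Filter.Tendsto (fun y => ν.real (Iic y)) (nhdsWithin (sInf s) (Iio (sInf s)))
        (nhds (ν.real (Iic (sInf s)))) := hcont.continuousAt.tendsto.mono_left nhdsWithin_le_nhds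
    refine le_of_tendsto hlim ?_
    filter_upwards [self_mem_nhdsWithin] with y hy
    by_contra hlt
    push Not at hlt
    exact absurd (csInf_le hbdd hlt.le) (not_le.2 hy)
  · exact hclosed.csInf_mem hne hbdd

/-- The expected shortfall identifies the mean of the negative part of the residual. -/
lemma HasExpectedShortfall.integral_max_sub (h : HasExpectedShortfall ν α e)
    (hq : quantile ν α = m) (hm : ν.real (Iic m) = α) (hα : 0 < α) :
    Integrable (fun y => max (m - y) 0) ν ∧ ∫ y, max (m - y) 0 ∂ν = α * (m - e) := by
  obtain ⟨hi, he⟩ := h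
  rw [hq] at hi he
  have hi' : IntegrableOn (fun y => m - y) (Iic m) ν := (integrable_const m).sub hi
  rw [max_sub_eq_indicator]
  refine ⟨hi'.integrable_indicator measurableSet_Iic, ?_⟩
  rw [integral_indicator measurableSet_Iic, integral_sub (integrable_const _) hi]
  rw [ProbabilityTheory.cond, integral_smul_measure, ENNReal.toReal_inv, smul_eq_mul] at he
  rw [show (ν (Iic m)).toReal = α from hm, inv_mul_eq_iff_eq_mul₀ hα.ne'] at he
  rw [he]
  simp [hm]
  ring

/-- Neyman orthogonality: the conditional mean of the score is quadratic in the first-stage error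
`d`. -/
lemma abs_integral_score_le (hint : Integrable (fun y => max (m - y) 0) ν)
    (hi : ∫ y, max (m - y) 0 ∂ν = α * (m - e)) (hm : ν.real (Iic m) = α)
    (hcdf : ∀ s, |ν.real (Iic (m + s)) - α| ≤ f * |s|) (d : ℝ) :
    |∫ y, (max (d - (y - m)) 0 - α * d + α * (e - m)) ∂ν| ≤ f * d ^ 2 := by
  -- The increment of `max` lies between its one-sided tangents.
  have hlow : ∀ y, (Iic m).indicator (fun _ => d) y ≤ max (d - (y - m)) 0 - max (m - y) 0 := by
    intro y
    by_cases hy : y ≤ m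
    · rw [indicator_of_mem (mem_Iic.2 hy), max_eq_left (by linarith : 0 ≤ m - y)]
      linarith [le_max_left (d - (y - m)) 0]
    · rw [indicator_of_notMem (by simpa using hy), max_eq_right (by linarith : m - y ≤ 0)]
      linarith [le_max_right (d - (y - m)) 0]
  have hupp : ∀ y,
      max (d - (y - m)) 0 - max (m - y) 0 ≤ (Iic (m + d)).indicator (fun _ => d) y := by
    intro y
    by_cases hy : y ≤ m + d
    · rw [indicator_of_mem (mem_Iic.2 hy), max_eq_left (by linarith : 0 ≤ d - (y - m))]
      linarith [le_max_left (m - y) 0]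
    · rw [indicator_of_notMem (by simpa using hy), max_eq_right (by linarith : d - (y - m) ≤ 0)]
      linarith [le_max_right (m - y) 0]
  have i1 : Integrable ((Iic m).indicator fun _ => d) ν :=
    (integrable_const d).indicator measurableSet_Iic
  have i2 : Integrable ((Iic (m + d)).indicator fun _ => d) ν :=
    (integrable_const d).indicator measurableSet_Iic
  have i3 : Integrable (fun y => max (d - (y - m)) 0 - max (m - y) 0) ν := by
    refine (i1.abs.add i2.abs).mono' (by fun_prop) (Filter.Eventually.of_forall fun y => ?_)
    rw [Real.norm_eq_abs, Pi.add_apply, abs_le]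
    constructor
    · linarith [hlow y, neg_abs_le ((Iic m).indicator (fun _ => d) y),
        abs_nonneg ((Iic (m + d)).indicator (fun _ => d) y)]
    · linarith [hupp y, le_abs_self ((Iic (m + d)).indicator (fun _ => d) y),
        abs_nonneg ((Iic m).indicator (fun _ => d) y)]
  have h1 := integral_mono i1 i3 hlow
  have h2 := integral_mono i3 i2 hupp
  rw [integral_indicator_const _ measurableSet_Iic, smul_eq_mul] at h1 h2
  rw [hm] at h1
  have hsplit : ∫ y, (max (d - (y - m)) 0 - α * d + α * (e - m)) ∂ν =
      ∫ y, (max (d - (y - m)) 0 - max (m - y) 0) ∂ν - α * d := by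
    have : ∀ y, max (d - (y - m)) 0 - α * d + α * (e - m) =
        (max (d - (y - m)) 0 - max (m - y) 0) + (max (m - y) 0 + (α * (e - m) - α * d)) :=
      fun y => by ring
    simp_rw [this]
    have i4 : Integrable (fun y => max (m - y) 0 + (α * (e - m) - α * d)) ν :=
      hint.add (integrable_const _)
    rw [integral_add i3 i4, integral_add hint (integrable_const _), hi]
    simp
    ring
  rw [hsplit]
  have h3 : |(ν.real (Iic (m + d)) - α) * d| ≤ f * d ^ 2 := by
    calc |(ν.real (Iic (m + d)) - α) * d| = |ν.real (Iic (m + d)) - α| * |d| := abs_mul _ _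
      _ ≤ f * |d| * |d| := mul_le_mul_of_nonneg_right (hcdf d) (abs_nonneg _)
      _ = f * d ^ 2 := by rw [mul_assoc, abs_mul_abs_self, sq]
  rw [abs_le]
  constructor
  · linarith [(abs_nonneg _).trans h3]
  · linarith [(le_abs_self _).trans h3]

end Conditional

/-! ### The regression model in whitened coordinates -/

section Model

variable {p : ℕ} {ρ : Measure (Vec p × ℝ)} {α fbar sbar υ : ℝ} {βstar θstar : Vec p}

/-- The orthogonal score at the true second-stage parameter, as a function of the whitened
first-stage error `η`. -/
def whitenedScore (A : Matrix (Fin p) (Fin p) ℝ) (α : ℝ) (βstar θstar η : Vec p)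
    (s : Vec p × ℝ) : ℝ :=
  max (inner ℝ η (whiten A s.1) - (s.2 - inner ℝ s.1 βstar)) 0 - α * inner ℝ η (whiten A s.1) +
    α * (inner ℝ s.1 θstar - inner ℝ s.1 βstar)

lemma score_eq {A : Matrix (Fin p) (Fin p) ℝ} (hA : A.PosDef) (β θ x : Vec p) (y : ℝ) :
    score α β θ x y = whitenedScore A α βstar θstar (color A (β - βstar)) (x, y) +
      inner ℝ (color A (α • (θ - θstar))) (whiten A x) := by
  simp only [score, whitenedScore, inner_color_whiten hA, inner_smul_right, inner_sub_right]
  by_cases h : y ≤ inner ℝ x β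
  · rw [if_pos h, max_eq_left (by linarith)]; ring
  · rw [if_neg h, max_eq_right (by linarith)]; ring

lemma lintegral_fst {g : Vec p → ENNReal} (hg : Measurable g) :
    ∫⁻ s, g s.1 ∂ρ = ∫⁻ x, g x ∂ρ.fst := by
  rw [Measure.fst, lintegral_map hg measurable_fst]

lemma integral_fst {g : Vec p → ℝ} (hg : Measurable g) :
    ∫ s, g s.1 ∂ρ = ∫ x, g x ∂ρ.fst := by
  rw [Measure.fst, integral_map measurable_fst.aemeasurable hg.aestronglyMeasurable]

variable [IsProbabilityMeasure ρ]

/-- What the model says about the conditional law of the response given almost every covariate. -/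
lemma ae_condKernel (hα : 0 < α) (hα2 : α ≤ 1 / 2) (hJ : JointModel ρ α βstar θstar)
    (hR : ResidualCondition ρ βstar fbar sbar) :
    ∀ᵐ x ∂ρ.fst, (∫⁻ y, ENNReal.ofReal ((max (inner ℝ x βstar - y) 0 +
        α * (inner ℝ x θstar - inner ℝ x βstar)) ^ 2) ∂(ρ.condKernel x) ≤
          ENNReal.ofReal (sbar ^ 2)) ∧
      ∀ d : ℝ, |∫ y, (max (d - (y - inner ℝ x βstar)) 0 - α * d +
        α * (inner ℝ x θstar - inner ℝ x βstar)) ∂(ρ.condKernel x)| ≤ fbar * d ^ 2 := by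
  filter_upwards [hJ.quantile_eq, hJ.shortfall_eq, hR.contDiff_cdf, hR.cdf_sub_le, hR.variance_le]
    with x hq hs hc hl hv
  have hres : ∀ s, (residualLaw ρ βstar x).real (Iic s) =
      (ρ.condKernel x).real (Iic (inner ℝ x βstar + s)) := by
    intro s
    rw [residualLaw, map_measureReal_apply (by fun_prop) measurableSet_Iic]
    congr 1
    ext y
    simp only [mem_preimage, mem_Iic, sub_le_iff_le_add, add_comm]
  have hcont : Continuous fun y => (ρ.condKernel x).real (Iic y) := by
    have := hc.continuous.comp (continuous_id.sub continuous_const : Continuous fun y : ℝ =>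
      y - inner ℝ x βstar)
    simpa [Function.comp_def, hres] using this
  have hm := measureReal_Iic_quantile hα (by linarith) hcont
  rw [hq] at hm
  obtain ⟨hint, hi⟩ := hs.integral_max_sub hq hm hα
  refine ⟨lintegral_score_sq_le hi hv, abs_integral_score_le hint hi hm fun s => ?_⟩
  have := hl s
  rwa [hres, hres, add_zero, hm] at this

lemma whitenedModel (hα : 0 < α) (hα2 : α ≤ 1 / 2) (hυ : 0 < υ) (hJ : JointModel ρ α βstar θstar)
    (hR : ResidualCondition ρ βstar fbar sbar) (hC : SubGaussianCovariates ρ.fst υ) :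
    WhitenedModel ρ (fun s => whiten (secondMoment ρ.fst) s.1)
      (whitenedScore (secondMoment ρ.fst) α βstar θstar) (1 / (4 * υ ^ 2)) sbar fbar := by
  set A := secondMoment ρ.fst
  have hA : A.PosDef := hC.posDef
  have hmw : Measurable (whiten A) := measurable_whiten
  have hmi : ∀ u, Measurable fun x => inner ℝ u (whiten A x) := fun u =>
    (continuous_const.inner continuous_id).measurable.comp hmw
  have hmx : ∀ b : Vec p, Measurable fun s : Vec p × ℝ => inner ℝ s.1 b := fun b =>
    (continuous_id.inner continuous_const).measurable.comp measurable_fst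
  have hms : ∀ η, Measurable (whitenedScore A α βstar θstar η) := fun η => by
    have h1 := (hmi η).comp (measurable_fst : Measurable (Prod.fst : Vec p × ℝ → Vec p))
    have h2 := hmx βstar
    have h3 := hmx θstar
    have h4 : Measurable fun s : Vec p × ℝ => s.2 := measurable_snd
    exact (((h1.sub (h4.sub h2)).max measurable_const).sub (h1.const_mul α)).add
      ((h3.sub h2).const_mul α)
  have hae := ae_condKernel hα hα2 hJ hR
  refine ⟨hmw.comp measurable_fst, hms, fun u hu => ?_, fun u => ?_, fun η η' s => ?_,
    fun g hg => ?_, fun η u hi hi' => ?_⟩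
  · rw [lintegral_fst (g := fun x => ENNReal.ofReal
      (Real.exp (1 / (4 * υ ^ 2) * inner ℝ u (whiten A x) ^ 2))) (by have := hmi u; fun_prop)]
    rcases eq_or_ne u 0 with rfl | hu0
    · simp
    · have hpos : 0 < ‖u‖ := norm_pos_iff.2 hu0
      have h1 : ‖‖u‖⁻¹ • u‖ = 1 := by
        rw [norm_smul, norm_inv, norm_norm, inv_mul_cancel₀ hpos.ne']
      refine le_trans (lintegral_mono fun x => ?_)
        (lintegral_exp_sq_le_of_tail (hmi (‖u‖⁻¹ • u)) hυ (hC.tail_le _ h1))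
      refine ENNReal.ofReal_le_ofReal (Real.exp_le_exp.2
        (mul_le_mul_of_nonneg_left ?_ (by positivity)))
      rw [real_inner_smul_left, mul_pow]
      have : 1 ≤ ‖u‖⁻¹ ^ 2 := one_le_pow₀ ((one_le_inv₀ hpos).2 hu)
      nlinarith [sq_nonneg (inner ℝ u (whiten A x))]
  · rw [integral_fst (g := fun x => inner ℝ u (whiten A x) ^ 2) ((hmi u).pow_const 2)]
    obtain ⟨b, rfl⟩ := exists_color_eq hA u
    simp_rw [inner_color_whiten hA]
    rw [integral_inner_sq hC.memLp_two, norm_color hA, matNorm, Real.sq_sqrt]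
    exact hA.posSemidef.dotProduct_mulVec_nonneg b.ofLp
  · simp only [whitenedScore, inner_sub_left]
    set d := inner ℝ η (whiten A s.1)
    set d' := inner ℝ η' (whiten A s.1)
    set z := s.2 - inner ℝ s.1 βstar
    rcases le_total d d' with hd | hd
    · have h1 : max (d - z) 0 ≤ max (d' - z) 0 := max_le_max (by linarith) le_rfl
      have h2 : max (d' - z) 0 ≤ max (d - z) 0 + (d' - d) :=
        max_le (by linarith [le_max_left (d - z) 0]) (by linarith [le_max_right (d - z) 0])
      rw [abs_of_nonpos (by linarith : d - d' ≤ 0), abs_le]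
      constructor <;> nlinarith
    · have h1 : max (d' - z) 0 ≤ max (d - z) 0 := max_le_max (by linarith) le_rfl
      have h2 : max (d - z) 0 ≤ max (d' - z) 0 + (d - d') :=
        max_le (by linarith [le_max_left (d' - z) 0]) (by linarith [le_max_right (d' - z) 0])
      rw [abs_of_nonneg (by linarith : 0 ≤ d - d'), abs_le]
      constructor <;> nlinarith
  · have hm0 := hms 0
    have hgm : Measurable fun x => g (whiten A x) := hg.comp hmw
    have hmp : Measurable fun s : Vec p × ℝ =>
        ENNReal.ofReal (whitenedScore A α βstar θstar 0 s ^ 2) * g (whiten A s.1) :=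
      ((hm0.pow_const 2).ennreal_ofReal).mul (hgm.comp measurable_fst)
    rw [lintegral_fst hgm, ← Measure.lintegral_condKernel hmp, ← lintegral_const_mul _ hgm]
    refine lintegral_mono_ae ?_
    filter_upwards [hae] with x hx
    have hmy : Measurable fun y => ENNReal.ofReal (whitenedScore A α βstar θstar 0 (x, y) ^ 2) :=
      ((hm0.comp measurable_prodMk_left).pow_const 2).ennreal_ofReal
    rw [lintegral_mul_const _ hmy]
    gcongr
    refine le_trans (le_of_eq (lintegral_congr fun y => ?_)) hx.1
    simp [whitenedScore]
  · have hgm : Measurable fun x => inner ℝ η (whiten A x) ^ 2 * |inner ℝ u (whiten A x)| :=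
      ((hmi η).pow_const 2).mul (hmi u).abs
    rw [← Measure.integral_condKernel hi, integral_fst hgm, ← integral_const_mul]
    have hi2 : Integrable (fun x => inner ℝ η (whiten A x) ^ 2 * |inner ℝ u (whiten A x)|)
        ρ.fst := by
      rw [Measure.fst, integrable_map_measure hgm.aestronglyMeasurable measurable_fst.aemeasurable]
      exact hi'
    rw [← Real.norm_eq_abs]
    refine norm_integral_le_of_norm_le (hi2.const_mul _) ?_
    filter_upwards [hae] with x hx
    rw [integral_mul_const, norm_mul, Real.norm_eq_abs, Real.norm_eq_abs, ← mul_assoc]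
    exact mul_le_mul_of_nonneg_right (hx.2 (inner ℝ η (whiten A x))) (abs_nonneg _)

end Model

end ESReg

end

theorem theorem4p4 :
    -- The constants depend only on `υ` and on the constants hidden in `≍` and `≲`.
    ∀ υ cτ Cτ K₁ K₂ : ℝ, 1 ≤ υ → 0 < cτ → cτ ≤ Cτ → 0 < K₁ → 0 < K₂ →
    ∃ C₁ C₂ C₃ : ℝ, 0 < C₁ ∧ 0 < C₂ ∧ 0 < C₃ ∧
    ∀ (n p : ℕ) (α fbar sbar t r₀ τ : ℝ),
      0 < α → α ≤ 1 / 2 → 0 < fbar → 0 < sbar → 0 < t → 0 < r₀ →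
      r₀ ≤ K₁ * sbar →
      fbar * r₀ ^ 2 ≤ K₂ * (sbar * Real.sqrt ((p + t) / n)) →
      cτ * (sbar * Real.sqrt (n / (p + t))) ≤ τ →
      τ ≤ Cτ * (sbar * Real.sqrt (n / (p + t))) →
      C₃ * (p + t) ≤ n →
    -- The population `(X, Y) ∼ ρ`.
    ∀ (ρ : Measure (ESReg.Vec p × ℝ)) [IsProbabilityMeasure ρ] (βstar θstar : ESReg.Vec p),
      ESReg.JointModel ρ α βstar θstar →
      ESReg.ResidualCondition ρ βstar fbar sbar →
      ESReg.SubGaussianCovariates ρ.fst υ →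
    -- The sample: `n` independent copies of `(X, Y)`.
    ∀ {Ω : Type*} [MeasurableSpace Ω] (P : Measure Ω) [IsProbabilityMeasure P]
      (X : Fin n → Ω → ESReg.Vec p) (Y : Fin n → Ω → ℝ),
      (∀ i, Measurable (X i)) → (∀ i, Measurable (Y i)) →
      (∀ i, P.map (fun ω => (X i ω, Y i ω)) = ρ) →
      iIndepFun (fun i ω => (X i ω, Y i ω)) P →
    -- The two-step estimator.
    ∀ (βhat θhat : Ω → ESReg.Vec p),
      (∀ ω, ESReg.IsQREstimate α (fun i => X i ω) (fun i => Y i ω) (βhat ω)) →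
      (∀ ω, ESReg.IsHuberESEstimate α τ (fun i => X i ω) (fun i => Y i ω) (βhat ω) (θhat ω)) →
    -- With probability at least `1 - 3 exp(-t)`: if the first stage lands in the `Σ`-ball of radius
    -- `r₀` around `βstar`, then the deviation bound holds.
    ∃ G : Set Ω, MeasurableSet G ∧ 1 - 3 * Real.exp (-t) ≤ P.real G ∧
      ∀ ω ∈ G,
        ESReg.matNorm (ESReg.secondMoment ρ.fst) (βhat ω - βstar) ≤ r₀ →
        α * ESReg.matNorm (ESReg.secondMoment ρ.fst) (θhat ω - θstar) ≤
          C₁ * (sbar * Real.sqrt ((p + t) / n)) +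
            C₂ * (Real.sqrt ((p + t) / n) * r₀ + fbar * r₀ ^ 2) := by
  intro υ cτ Cτ K₁ K₂ hυ hcτ _ hK₁ hK₂
  have hυ0 : 0 < υ := by linarith
  have hc1 : 1 / (4 * υ ^ 2) ≤ 1 := by
    rw [div_le_one (by positivity)]; nlinarith
  obtain ⟨C, q₀, hC, hq₀, H⟩ := ESReg.WhitenedModel.exists_const_norm_le (c := 1 / (4 * υ ^ 2))
    (Cτ := Cτ) (by positivity) hc1 hcτ hK₁ hK₂
  refine ⟨C, 1, 1 / q₀ ^ 2, hC, one_pos, by positivity, ?_⟩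
  intro n p α fbar sbar t r₀ τ hα hα2 hf hs ht hr hrK hfK hτ1 hτ2 hn ρ _ βstar θstar hJ hR hX
    Ω _ P _ X Y hXm hYm hlaw hind βhat θhat _ hθ
  -- For small `t` the probability bound is void.
  rcases le_or_gt (1 - 3 * Real.exp (-t)) 0 with htriv | hbig
  · exact ⟨∅, MeasurableSet.empty, by simpa using htriv, by simp⟩
  have ht1 : 1 ≤ t := by
    by_contra hlt
    push Not at hlt
    have h1 : Real.exp (-1) ≤ Real.exp (-t) := Real.exp_le_exp.2 (by linarith)
    have h2 : 1 / 3 ≤ Real.exp (-1) := by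
      rw [Real.exp_neg, one_div]
      exact inv_anti₀ (Real.exp_pos _) (by linarith [Real.exp_one_lt_d9])
    linarith
  have hpt : (0 : ℝ) < p + t := by positivity
  have hn0 : (0 : ℝ) < n := lt_of_lt_of_le (by positivity) hn
  set q := Real.sqrt ((p + t) / n) with hq
  have hq0 : 0 < q := Real.sqrt_pos.2 (by positivity)
  have hq2 : q ^ 2 = (p + t) / n := Real.sq_sqrt (by positivity)
  have hqinv : Real.sqrt (n / (p + t)) = q⁻¹ := by
    rw [hq, ← Real.sqrt_inv, inv_div]
  rw [hqinv] at hτ1 hτ2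
  have hqq₀ : q ≤ q₀ := by
    refine Real.sqrt_le_iff.2 ⟨hq₀.le, ?_⟩
    rw [div_le_iff₀ hn0]
    rw [one_div, inv_mul_le_iff₀ (by positivity)] at hn
    exact hn
  have hA := hX.posDef
  obtain ⟨G, hG, hPG, hGn⟩ := H n p sbar fbar t r₀ τ q hs hf.le ht1 hr hq0 hqq₀
    (by rw [hq2]; field_simp) hrK hfK
    (by
      have := mul_le_mul_of_nonneg_left hτ1 hq0.le
      calc cτ * sbar = q * (cτ * (sbar * q⁻¹)) := by field_simp
        _ ≤ _ := this)
    (by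
      have := mul_le_mul_of_nonneg_left hτ2 hq0.le
      calc q * τ ≤ q * (Cτ * (sbar * q⁻¹)) := this
        _ = _ := by field_simp)
    ρ P _ _ (fun i ω => (X i ω, Y i ω)) (ESReg.whitenedModel hα hα2 hυ0 hJ hR hX)
    ⟨fun i => (hXm i).prodMk (hYm i), hlaw, hind⟩
  refine ⟨G, hG, ?_, fun ω hω hβ => ?_⟩
  · rw [probReal_compl_eq_one_sub hG] at hPG
    have h1 : Real.exp (-2 * t) = Real.exp (-t) * Real.exp (-t) := by
      rw [← Real.exp_add]; congr 1; ring
    nlinarith [Real.exp_pos (-t)]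
  rw [← ESReg.norm_color hA] at hβ
  have hloss : ∀ θ, ESReg.esLoss α τ (fun i => X i ω) (fun i => Y i ω) (βhat ω) θ =
      ESReg.empMean (fun i ω => (X i ω, Y i ω)) (fun s => ESReg.huber τ
        (ESReg.whitenedScore (ESReg.secondMoment ρ.fst) α βstar θstar
          (ESReg.color (ESReg.secondMoment ρ.fst) (βhat ω - βstar)) s +
          inner ℝ (ESReg.color (ESReg.secondMoment ρ.fst) (α • (θ - θstar)))
            (ESReg.whiten (ESReg.secondMoment ρ.fst) s.1))) ω := by
    intro θ
    simp only [ESReg.esLoss, ESReg.empMean]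
    congr 1
    refine Finset.sum_congr rfl fun i _ => ?_
    rw [ESReg.score_eq (βstar := βstar) (θstar := θstar) hA]
  have key := hGn ω hω _ hβ (ESReg.color (ESReg.secondMoment ρ.fst) (α • (θhat ω - θstar)))
    fun δ' => by
      obtain ⟨b, rfl⟩ := ESReg.exists_color_eq hA δ'
      have hb : α • ((θstar + α⁻¹ • b) - θstar) = b := by
        rw [add_sub_cancel_left, smul_inv_smul₀ hα.ne']
      have := hθ ω (θstar + α⁻¹ • b)
      rwa [hloss, hloss, hb] at this
  rw [ESReg.color_smul, norm_smul, Real.norm_of_nonneg hα.le, ESReg.norm_color hA] at key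
  have : 0 ≤ 1 * (q * r₀ + fbar * r₀ ^ 2) := by positivity
  linarith
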